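/- Let $X$ and $Y$ be nonempty sets and let $\mathcal H=(h_y)_{y\in Y}$ be a family of functions $h_y:X\to[0,1]$. **Definitions.** Let $\mathcal F$ be a class of functions on a set $S$ with values in $[0,1]$. *Fat-shattering.* For $\gamma\in(0,1]$, $\mathcal F$ $\gamma$-fat-shatters $A\subseteq S$ if there is $s:A\to[0,1]$ such that for every $E\subseteq A$ some $f\in\mathcal F$ satisfies $f(x)\ge s(x)+\gamma$ for $x\in E$ and $f(x)\le s(x)-\gamma$ for $x\in A\setminus E$. The $\gamma$ fat-shattering dimension of $\mathcal F$ is the supremum of the cardinalities of the sets that it $\gamma$-fat-shatters. *Learnability.* For a probability measure $P$ on $S\times[0,1]$ let $L_P(f)=\int (f(x)-t)^2\,dP(x,t)$. The class $\mathcal F$ is agnostic PAC learnable if for all $\delta,\epsilon>0$ there are a map $A$ from finite sequences in $S\times[0,1]$ to $\mathcal F$ and a number $n_0$ such that for all $n\ge n_0$ and all probability measures $P$ on $S\times[0,1]$ (with respect to the product of any $\sigma$-algebra on $S$ making all $f\in\mathcal F$ measurable and the Borel $\sigma$-algebra of $[0,1]$), the inequality $L_P(A(z))\le\inf_{f\in\mathcal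 F}L_P(f)+\epsilon$ holds with $P^n$-probability at least $1-\delta$ over $z$ (that is, the set of $z$ where it fails has outer $P^n$-measure at most $\delta$). *Distribution classes.* The distribution function class of $\mathcal H$ is the class of all functions $x\mapsto\mathbb E_{y\sim\mu}[h_y(x)]$ on $X$, where $\mu$ is a probability measure on $Y$, on any $\sigma$-algebra for which $y\mapsto h_y(x)$ is measurable for every $x\in X$. The dual distribution function class of $\mathcal H$ is the class of all functions $y\mapsto\mathbb E_{x\sim\mu}[h_y(x)]$ on $Y$, where $\mu$ is a probability measure on $X$, on any $\sigma$-algebra for which every $h_y$ is measurable. **Theorem.** Suppose that $\mathcal H$ is agnostic PAC learnable, or that $\mathcal H$ has finite $\gamma$ fat-shattering dimension for every $\gamma\in(0,1]$. Then 1. the dual distribution function class and the distribution function class of $\mathcal H$ both have finite $\gamma$ fat-shattering dimension for every $\gamma\in(0,1]$; 2. if $X$ is countable, the dual distribution function class of $\mathcal H$ is agnostic PAC learnable; 3. if $Y$ is countable, the distribution function class of $\mathcal H$ is agnostic PAC learnable. -/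

import Mathlib

open MeasureTheory

namespace HypothesisClass

/-- `F` `γ`-fat-shatters `A`: there are witness levels `s : A → [0,1]` such that every `E ⊆ A` is
cut out of `A` with margin `γ` by some function of `F`. -/
def FatShatters {X : Type*} (F : Set (X → ℝ)) (γ : ℝ) (A : Set X) : Prop :=
  ∃ s : A → Set.Icc (0 : ℝ) 1, ∀ E : Set X, E ⊆ A → ∃ f ∈ F, ∀ x : A,
    ((x : X) ∉ E → f x ≤ (s x : ℝ) - γ) ∧ ((x : X) ∈ E → (s x : ℝ) + γ ≤ f x)

/-- The `γ` fat-shattering dimension: the supremum of the cardinalities of `γ`-fat-shattered sets. -/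
noncomputable def fatShatteringDim {X : Type*} (F : Set (X → ℝ)) (γ : ℝ) : ℕ∞ :=
  ⨆ (A : Set X) (_ : FatShatters F γ A), A.encard

/-- The `γ` fat-shattering dimension is finite for each `γ ∈ (0,1]`. -/
def FiniteFatShattering {X : Type*} (F : Set (X → ℝ)) : Prop :=
  ∀ γ : ℝ, 0 < γ → γ ≤ 1 → fatShatteringDim F γ < ⊤

/-- The expected squared loss of the hypothesis `f` under a distribution `P` on `X × [0,1]`. -/
noncomputable def expLoss {X : Type*} [MeasurableSpace X] (P : Measure (X × Set.Icc (0 : ℝ) 1))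
    (f : X → ℝ) : ℝ :=
  ∫ z, (f z.1 - (z.2 : ℝ)) ^ 2 ∂P

/-- The infimum of the expected loss over the class `F`. -/
noncomputable def bestExpLoss {X : Type*} [MeasurableSpace X]
    (P : Measure (X × Set.Icc (0 : ℝ) 1)) (F : Set (X → ℝ)) : ℝ :=
  ⨅ f : F, expLoss P (f : X → ℝ)

/-- `F` is `δ, ε` agnostic PAC learnable. A learning procedure maps finite sequences of samples to
hypotheses of the class `F` itself. Distributions on `X × [0,1]` are taken with respect to an
arbitrary σ-algebra on `X` for which all hypotheses are measurable; the procedure and the number of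
samples depend neither on the σ-algebra nor on the distribution. The failure event need not be
measurable, and `Measure.pi` gives its outer probability, so the condition says that success holds
on a measurable event of probability at least `1 - δ`. -/
def AgnosticPACLearnableWith {X : Type*} (F : Set (X → ℝ)) (δ ε : ℝ) : Prop :=
  ∃ (A : (n : ℕ) → (Fin n → X × Set.Icc (0 : ℝ) 1) → F) (n₀ : ℕ), ∀ n : ℕ, n₀ ≤ n →
    ∀ [MeasurableSpace X], (∀ f ∈ F, Measurable f) →
      ∀ P : Measure (X × Set.Icc (0 : ℝ) 1), IsProbabilityMeasure P →
        Measure.pi (fun _ : Fin n => P)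
          {z | ¬ expLoss P (A n z : X → ℝ) ≤ bestExpLoss P F + ε} ≤ ENNReal.ofReal δ

/-- `F` is agnostic PAC learnable. -/
def AgnosticPACLearnable {X : Type*} (F : Set (X → ℝ)) : Prop :=
  ∀ δ ε : ℝ, 0 < δ → 0 < ε → AgnosticPACLearnableWith F δ ε

/-- The distribution function class of the family `h` of functions on `X` indexed by `Y`: all
functions `x ↦ 𝔼_{y ∼ μ} [h y x]`, where `μ` ranges over the probability measures on `Y`, on any
σ-algebra for which `y ↦ h y x` is measurable for every `x`. -/
def distributionClass {X Y : Type*} (h : Y → X → ℝ) : Set (X → ℝ) :=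
  {f | ∃ (m : MeasurableSpace Y) (μ : @Measure Y m), IsProbabilityMeasure μ ∧
    (∀ x, Measurable fun y => h y x) ∧ ∀ x, f x = ∫ y, h y x ∂μ}

/-- The dual family: functions on `Y` indexed by `X`. -/
def dualFamily {X Y : Type*} (h : Y → X → ℝ) : X → Y → ℝ := fun x y => h y x

/-- The dual distribution function class: all functions `y ↦ 𝔼_{x ∼ μ} [h y x]` on `Y`. -/
def dualDistributionClass {X Y : Type*} (h : Y → X → ℝ) : Set (Y → ℝ) :=
  distributionClass (dualFamily h)

end HypothesisClass

/-! Learnability forces finite fat-shattering dimension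
(`AgnosticPACLearnable.finiteFatShattering`), so that may be assumed. If `d` points are shattered,
each sign pattern `b` gives a law with uniform points and Bernoulli labels of mean `f b`. A
near-optimal hypothesis determines most of `b`, yet a sample of fixed length `n` takes only `(2d)^n`
values, each of mass at most `d^(-n)`; for large `d` this is impossible.

Everything else rests on `exists_cover`: finite dimension at every scale gives, on any `n` points, a
uniform `η`-cover by `exp(o(n))` members of the family. After discretizing the levels, this is a
Sauer–Shelah bound for partial patterns.

For part 1, a mixture is never better correlated with a sign vector than the best `h y`. If mixtures
shattered `n` points, each of the `2^n` sign vectors would correlate with a cover element, while by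
Hoeffding each cover element serves only an exponentially small fraction of them. The dual class is
the distribution class of the dual family, to which finite dimension passes by Assouad's argument
(`FiniteFatShattering.dualFamily`).

For parts 2 and 3, the squared residual of a mixture is an average of products of residuals of pairs
`h y`, `h y'`. Uniform convergence over pairs, obtained from covers by symmetrization
(`integral_iSup_abs_deviation_le`), therefore passes to all mixtures (`abs_expLoss_sub_sum_le`), and
approximate empirical risk minimization learns. Countability makes the suprema measurable and allows
discrete mixing measures, hence Fubini. -/

namespace HypothesisClass

/-! ### Sign vectors and Hoeffding's inequality -/

/-- The sign `±1` of a Boolean. -/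
def sgn (b : Bool) : ℝ := if b then 1 else -1

lemma abs_sgn (b : Bool) : |sgn b| = 1 := by cases b <;> simp [sgn]

/-- Independence of the coordinates of a uniform sign vector: the sum of products factors over the
coordinates. -/
lemma sum_exp_sgn {ι : Type*} [Fintype ι] [DecidableEq ι] (a : ι → ℝ) :
    ∑ σ : ι → Bool, Real.exp (∑ i, sgn (σ i) * a i) = ∏ i, (2 * Real.cosh (a i)) := by
  have h1 : ∀ i, 2 * Real.cosh (a i) = ∑ b : Bool, Real.exp (sgn b * a i) := by
    intro i
    rw [Real.cosh_eq]
    simp only [Fintype.sum_bool, sgn, if_true, Bool.false_eq_true, if_false, one_mul, neg_one_mul]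
    ring
  simp_rw [h1, Finset.prod_univ_sum, Fintype.piFinset_univ, Real.exp_sum]

/-- Hoeffding's inequality for sign vectors, in counting form. -/
lemma card_sgn_sum_ge_le {ι : Type*} [Fintype ι] [DecidableEq ι] (a : ι → ℝ) {B τ : ℝ}
    (hB : 0 < B) (hτ : 0 ≤ τ) (ha : ∀ i, |a i| ≤ B) (S : Finset (ι → Bool))
    (hS : ∀ σ ∈ S, Fintype.card ι * τ ≤ ∑ i, sgn (σ i) * a i) :
    (S.card : ℝ) ≤ 2 ^ Fintype.card ι * Real.exp (-(Fintype.card ι * τ ^ 2 / (2 * B ^ 2))) := by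
  set n := Fintype.card ι with hn
  -- The Chernoff parameter minimizing `l ^ 2 * B ^ 2 / 2 - l * τ`.
  set l := τ / B ^ 2 with hl
  have hl0 : 0 ≤ l := by positivity
  have h1 : (S.card : ℝ) * Real.exp (l * (n * τ)) ≤
      ∑ σ : ι → Bool, Real.exp (∑ i, sgn (σ i) * (l * a i)) := by
    rw [← nsmul_eq_mul]
    refine le_trans (Finset.card_nsmul_le_sum S (fun σ => Real.exp (∑ i, sgn (σ i) * (l * a i)))
      _ ?_) (Finset.sum_le_sum_of_subset_of_nonneg (Finset.subset_univ _)
        fun _ _ _ => (Real.exp_pos _).le)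
    intro σ hσ
    have : ∑ i, sgn (σ i) * (l * a i) = l * ∑ i, sgn (σ i) * a i := by
      rw [Finset.mul_sum]
      exact Finset.sum_congr rfl fun i _ => by ring
    rw [this]
    exact Real.exp_le_exp.2 (mul_le_mul_of_nonneg_left (hS σ hσ) hl0)
  have h2 : ∏ i, (2 * Real.cosh (l * a i)) ≤
      ∏ _i : ι, (2 * Real.exp (l ^ 2 * B ^ 2 / 2)) := by
    refine Finset.prod_le_prod (fun i _ => by positivity) fun i _ => ?_
    refine mul_le_mul_of_nonneg_left ((Real.cosh_le_exp_half_sq _).trans ?_) zero_le_two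
    refine Real.exp_le_exp.2 ?_
    have : a i ^ 2 ≤ B ^ 2 := sq_le_sq' (abs_le.1 (ha i)).1 (abs_le.1 (ha i)).2
    have := mul_le_mul_of_nonneg_left this (sq_nonneg l)
    rw [mul_pow]
    linarith
  rw [sum_exp_sgn] at h1
  rw [Finset.prod_const, Finset.card_univ, mul_pow, ← Real.exp_nat_mul, ← hn] at h2
  have h3 := h1.trans h2
  have h4 : (n : ℝ) * (l ^ 2 * B ^ 2 / 2) - l * (n * τ) = -(n * τ ^ 2 / (2 * B ^ 2)) := by
    rw [hl]; field_simp; ring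
  rw [← h4, Real.exp_sub, ← mul_div_assoc, le_div_iff₀ (Real.exp_pos _)]
  exact h3

/-! ### A Sauer–Shelah bound for partial patterns -/

/-- `T` is shattered by a family of partial patterns: `pos p j` and `neg p j` say that the pattern
`p` takes the value one, respectively zero, at `j`. -/
def PatternShatters {P J : Type*} (pos neg : P → J → Prop) (Q : Finset P) (T : Finset J) : Prop :=
  ∀ E ⊆ T, ∃ p ∈ Q, (∀ j ∈ E, pos p j) ∧ ∀ j ∈ T, j ∉ E → neg p j

lemma PatternShatters.mono {P J : Type*} {pos neg : P → J → Prop} {Q Q' : Finset P} {T : Finset J}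
    (hT : PatternShatters pos neg Q T) (hQ : Q ⊆ Q') : PatternShatters pos neg Q' T := by
  intro E hE
  obtain ⟨p, hp, h⟩ := hT E hE
  exact ⟨p, hQ hp, h⟩

open Classical in
/-- Two large classes of patterns that disagree at a common place. -/
lemma exists_split_of_separated {P J : Type*} [Fintype J] (pos neg : P → J → Prop)
    (Q : Finset P) (hsep : ∀ p ∈ Q, ∀ q ∈ Q, p ≠ q → ∃ j, pos p j ∧ neg q j ∨ neg p j ∧ pos q j)
    (M : ℕ) (hM : 1 ≤ M) (hJ : 1 ≤ Fintype.card J) (hQ : 2 * Fintype.card J * M ≤ Q.card) :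
    ∃ j, M ≤ (Q.filter (pos · j)).card ∧ M ≤ (Q.filter (neg · j)).card := by
  by_contra! hc
  -- If no place splits `Q`, every `j` has a side with fewer than `M` patterns, here `R j`. Deleting
  -- all these minorities leaves two patterns, and whichever place separates them puts one of them
  -- in a minority.
  let R : J → Finset P := fun j =>
    if M ≤ (Q.filter (pos · j)).card then Q.filter (neg · j) else Q.filter (pos · j)
  have hR : ∀ j, (R j).card ≤ M - 1 := by
    intro j
    by_cases h : M ≤ (Q.filter (pos · j)).card
    · have := hc j h
      simp only [R, if_pos h]
      omega
    · simp only [R, if_neg h]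
      omega
  have hU : (Finset.univ.biUnion R).card ≤ Fintype.card J * (M - 1) :=
    Finset.card_biUnion_le_card_mul _ _ _ fun j _ => hR j
  have h1 : 1 < (Q \ Finset.univ.biUnion R).card := by
    have h2 := Finset.le_card_sdiff (Finset.univ.biUnion R) Q
    obtain ⟨m, rfl⟩ := Nat.exists_eq_add_of_le' hM
    simp only [Nat.add_sub_cancel] at hU
    have : 2 * Fintype.card J * (m + 1) =
      Fintype.card J * m + (Fintype.card J * m + 2 * Fintype.card J) := by ring
    have h3 := Nat.zero_le (Fintype.card J * m)
    omega
  obtain ⟨p, hp, q, hq, hpq⟩ := Finset.one_lt_card.1 h1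
  simp only [Finset.mem_sdiff, Finset.mem_biUnion, Finset.mem_univ, true_and, not_exists] at hp hq
  obtain ⟨j, hj⟩ := hsep p hp.1 q hq.1 hpq
  have h2 := hp.2 j
  have h3 := hq.2 j
  by_cases h : M ≤ (Q.filter (pos · j)).card
  · simp only [R, if_pos h, Finset.mem_filter, not_and] at h2 h3
    tauto
  · simp only [R, if_neg h, Finset.mem_filter, not_and] at h2 h3
    tauto

open Classical in
/-- A large pairwise separated family of partial patterns shatters many sets. -/
lemma two_pow_le_card_patternShatters {P J : Type*} [Fintype J] (pos neg : P → J → Prop)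
    (hdisj : ∀ p j, pos p j → neg p j → False) (hJ : 1 ≤ Fintype.card J) (r : ℕ) (Q : Finset P)
    (hsep : ∀ p ∈ Q, ∀ q ∈ Q, p ≠ q → ∃ j, pos p j ∧ neg q j ∨ neg p j ∧ pos q j)
    (hQ : (2 * Fintype.card J) ^ r ≤ Q.card) :
    2 ^ r ≤ (Finset.univ.filter (PatternShatters pos neg Q)).card := by
  induction r generalizing Q with
  | zero =>
    simp only [pow_zero] at hQ ⊢
    obtain ⟨p, hp⟩ := Finset.card_pos.1 hQ
    refine Finset.card_pos.2 ⟨∅, ?_⟩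
    simp only [Finset.mem_filter, Finset.mem_univ, true_and]
    intro E hE
    rw [Finset.subset_empty.1 hE]
    exact ⟨p, hp, by simp, by simp⟩
  | succ r ih =>
    rw [pow_succ, mul_comm] at hQ
    obtain ⟨j, h1, h2⟩ := exists_split_of_separated pos neg Q hsep _
      (Nat.one_le_pow _ _ (by omega)) hJ hQ
    have hs : ∀ F : P → Prop, Q.filter F ⊆ Q := fun F => Finset.filter_subset _ _
    have i1 := ih (Q.filter (pos · j)) (fun p hp q hq => hsep p (hs _ hp) q (hs _ hq)) h1
    have i2 := ih (Q.filter (neg · j)) (fun p hp q hq => hsep p (hs _ hp) q (hs _ hq)) h2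
    set A := Finset.univ.filter (PatternShatters pos neg (Q.filter (pos · j))) with hA
    set B := Finset.univ.filter (PatternShatters pos neg (Q.filter (neg · j))) with hB
    -- All patterns of one half agree at `j`, so neither half shatters a set containing `j`.
    have hjA : ∀ T ∈ A, j ∉ T := by
      intro T hT hj
      obtain ⟨p, hp, _, hp3⟩ := (Finset.mem_filter.1 hT).2 ∅ (Finset.empty_subset _)
      exact hdisj p j (Finset.mem_filter.1 hp).2 (hp3 j hj (Finset.notMem_empty _))
    have hjB : ∀ T ∈ B, j ∉ T := by
      intro T hT hj
      obtain ⟨p, hp, hp2, _⟩ := (Finset.mem_filter.1 hT).2 T subset_rfl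
      exact hdisj p j (hp2 j hj) (Finset.mem_filter.1 hp).2
    -- A set shattered by both halves remains shattered by `Q` after adding `j`, since the choice of
    -- half prescribes the value at `j`. These new sets make up for the overlap in `|A ∪ B| + |A ∩
    -- B| = |A| + |B|`.
    have hins : ((A ∩ B).image (insert j)).card = (A ∩ B).card := by
      refine Finset.card_image_of_injOn fun T hT T' hT' h => ?_
      have hT := hjA T (Finset.mem_inter.1 hT).1
      have hT' := hjA T' (Finset.mem_inter.1 hT').1
      rw [← Finset.erase_insert hT, ← Finset.erase_insert hT']
      exact congrArg (Finset.erase · j) h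
    have hd : Disjoint (A ∪ B) ((A ∩ B).image (insert j)) := by
      rw [Finset.disjoint_left]
      intro T hT hT'
      obtain ⟨T', _, rfl⟩ := Finset.mem_image.1 hT'
      rcases Finset.mem_union.1 hT with h | h
      · exact hjA _ h (Finset.mem_insert_self _ _)
      · exact hjB _ h (Finset.mem_insert_self _ _)
    have hsub : (A ∪ B) ∪ (A ∩ B).image (insert j) ⊆
        Finset.univ.filter (PatternShatters pos neg Q) := by
      refine Finset.union_subset (Finset.union_subset ?_ ?_) ?_
      · intro T hT
        exact Finset.mem_filter.2 ⟨Finset.mem_univ _, (Finset.mem_filter.1 hT).2.mono (hs _)⟩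
      · intro T hT
        exact Finset.mem_filter.2 ⟨Finset.mem_univ _, (Finset.mem_filter.1 hT).2.mono (hs _)⟩
      · intro T' hT'
        obtain ⟨T, hT, rfl⟩ := Finset.mem_image.1 hT'
        have hTA := (Finset.mem_inter.1 hT).1
        have hTB := (Finset.mem_inter.1 hT).2
        have hjT := hjA T hTA
        refine Finset.mem_filter.2 ⟨Finset.mem_univ _, fun E hE => ?_⟩
        have hE' : E.erase j ⊆ T := by
          intro i hi
          obtain ⟨h1, h2⟩ := Finset.mem_erase.1 hi
          exact (Finset.mem_insert.1 (hE h2)).resolve_left h1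
        by_cases hj : j ∈ E
        · obtain ⟨p, hp, hp1, hp2⟩ := (Finset.mem_filter.1 hTA).2 _ hE'
          refine ⟨p, hs _ hp, fun i hi => ?_, fun i hi hiE => ?_⟩
          · by_cases hij : i = j
            · exact hij ▸ (Finset.mem_filter.1 hp).2
            · exact hp1 i (Finset.mem_erase.2 ⟨hij, hi⟩)
          · rcases Finset.mem_insert.1 hi with rfl | hi
            · exact absurd hj hiE
            · exact hp2 i hi fun h => hiE (Finset.mem_of_mem_erase h)
        · obtain ⟨p, hp, hp1, hp2⟩ := (Finset.mem_filter.1 hTB).2 _ hE'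
          refine ⟨p, hs _ hp, fun i hi => ?_, fun i hi hiE => ?_⟩
          · exact hp1 i (Finset.mem_erase.2 ⟨fun h => hj (h ▸ hi), hi⟩)
          · rcases Finset.mem_insert.1 hi with rfl | hi
            · exact (Finset.mem_filter.1 hp).2
            · exact hp2 i hi fun h => hiE (Finset.mem_of_mem_erase h)
    have hc := Finset.card_le_card hsub
    rw [Finset.card_union_of_disjoint hd, hins, Finset.card_union_add_card_inter] at hc
    rw [pow_succ]
    omega

/-- A set of size at most `d + 1` is one of size at most `d` with an optional extra element. Only
polynomial growth in `Fintype.card J` matters, so this crude count suffices. -/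
lemma card_filter_card_le {J : Type*} [Fintype J] [DecidableEq J] (d : ℕ) :
    ((Finset.univ : Finset (Finset J)).filter (·.card ≤ d)).card ≤ (Fintype.card J + 1) ^ d := by
  induction d with
  | zero =>
    refine Finset.card_le_one.2 fun a ha b hb => ?_
    simp only [Finset.mem_filter, Finset.mem_univ, true_and, Nat.le_zero,
      Finset.card_eq_zero] at ha hb
    rw [ha, hb]
  | succ d ih =>
    let g : Finset J × Option J → Finset J := fun p => p.2.elim p.1 fun j => insert j p.1
    have hsub : (Finset.univ : Finset (Finset J)).filter (·.card ≤ d + 1) ⊆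
        (((Finset.univ : Finset (Finset J)).filter (·.card ≤ d)) ×ˢ
          (Finset.univ : Finset (Option J))).image g := by
      intro T hT
      simp only [Finset.mem_filter, Finset.mem_univ, true_and] at hT
      rcases T.eq_empty_or_nonempty with rfl | ⟨j, hj⟩
      · exact Finset.mem_image.2 ⟨(∅, none), by simp, rfl⟩
      · refine Finset.mem_image.2 ⟨(T.erase j, some j), ?_, Finset.insert_erase hj⟩
        simp only [Finset.mem_product, Finset.mem_filter, Finset.mem_univ, true_and, and_true]
        rw [Finset.card_erase_of_mem hj]
        omega
    refine (Finset.card_le_card hsub).trans (Finset.card_image_le.trans ?_)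
    rw [Finset.card_product, Finset.card_univ, Fintype.card_option, pow_succ]
    exact Nat.mul_le_mul_right _ ih

/-- A pairwise separated family of partial patterns that shatters no large set is small. -/
lemma card_lt_of_separated {P J : Type*} [Fintype J] (pos neg : P → J → Prop)
    (hdisj : ∀ p j, pos p j → neg p j → False) (hJ : 1 ≤ Fintype.card J) (d r : ℕ) (Q : Finset P)
    (hsep : ∀ p ∈ Q, ∀ q ∈ Q, p ≠ q → ∃ j, pos p j ∧ neg q j ∨ neg p j ∧ pos q j)
    (hd : ∀ T, PatternShatters pos neg Q T → T.card ≤ d) (hr : (Fintype.card J + 1) ^ d < 2 ^ r) :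
    Q.card < (2 * Fintype.card J) ^ r := by
  classical
  by_contra! hc
  have h1 := two_pow_le_card_patternShatters pos neg hdisj hJ r Q hsep hc
  have h2 : (Finset.univ.filter (PatternShatters pos neg Q)).card ≤
      ((Finset.univ : Finset (Finset J)).filter (·.card ≤ d)).card :=
    Finset.card_le_card fun T hT =>
      Finset.mem_filter.2 ⟨Finset.mem_univ _, hd T (Finset.mem_filter.1 hT).2⟩
  have h3 := card_filter_card_le (J := J) d
  omega

/-! ### Fat-shattering of tuples -/

/-- `F` fat-shatters the points `x i` with margin `γ` around the levels `s i`. -/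
def FatShattersTuple {X ι : Type*} (F : Set (X → ℝ)) (γ : ℝ) (x : ι → X) (s : ι → ℝ) : Prop :=
  ∀ σ : ι → Bool, ∃ f ∈ F, ∀ i, (σ i = true → s i + γ ≤ f (x i)) ∧ (σ i = false → f (x i) ≤ s i - γ)

/-- At a repeated point, ask for a function above the larger level and below the smaller one. -/
lemma FatShattersTuple.injective {X ι : Type*} {F : Set (X → ℝ)} {γ : ℝ} {x : ι → X} {s : ι → ℝ}
    (h : FatShattersTuple F γ x s) (hγ : 0 < γ) : Function.Injective x := by
  classical
  have key : ∀ i j, i ≠ j → s i ≤ s j → x i ≠ x j := by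
    intro i j hij hs hx
    obtain ⟨f, _, hf⟩ := h fun k => decide (k = j)
    have h1 := (hf j).1 (by simp)
    have h2 := (hf i).2 (by simp [hij])
    rw [hx] at h2
    linarith
  intro i j hx
  by_contra hij
  rcases le_total (s i) (s j) with hs | hs
  · exact key i j hij hs hx
  · exact key j i (Ne.symm hij) hs hx.symm

/-- A finite fat-shattering dimension bounds the length of shattered tuples. -/
lemma exists_card_le_of_fatShatteringDim_lt_top {X : Type*} {F : Set (X → ℝ)} {γ : ℝ} (hγ : 0 < γ)
    (hF : fatShatteringDim F γ < ⊤) :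
    ∃ d : ℕ, ∀ (ι : Type) [Fintype ι] (x : ι → X) (s : ι → ℝ), (∀ i, s i ∈ Set.Icc (0 : ℝ) 1) →
      FatShattersTuple F γ x s → Fintype.card ι ≤ d := by
  classical
  obtain ⟨d, hd⟩ := ENat.ne_top_iff_exists.1 hF.ne
  refine ⟨d, fun ι _ x s hs h => ?_⟩
  have hinj := h.injective hγ
  have hA : FatShatters F γ (Set.range x) := by
    refine ⟨fun a => ⟨s a.2.choose, hs _⟩, fun E _ => ?_⟩
    obtain ⟨f, hf, hfs⟩ := h fun i => decide (x i ∈ E)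
    refine ⟨f, hf, fun a => ?_⟩
    have ha := a.2.choose_spec
    have h1 := hfs a.2.choose
    rw [ha] at h1
    simpa [and_comm] using h1
  have h2 : (Set.range x).encard ≤ fatShatteringDim F γ :=
    le_iSup₂ (f := fun (A : Set X) (_ : FatShatters F γ A) => A.encard) _ hA
  rw [← hd, ← Set.image_univ, hinj.encard_image, Set.encard_univ, ENat.card_eq_coe_fintype_card] at h2
  exact_mod_cast h2

/-- The fat-shattering dimension is finite if no tuple of some length is shattered. -/
lemma fatShatteringDim_lt_top {X : Type*} {F : Set (X → ℝ)} {γ : ℝ} (n : ℕ)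
    (hn : ∀ (x : Fin n → X) (s : Fin n → ℝ), (∀ i, s i ∈ Set.Icc (0 : ℝ) 1) →
      ¬ FatShattersTuple F γ x s) :
    fatShatteringDim F γ < ⊤ := by
  refine lt_of_le_of_lt (iSup₂_le fun A hA => ?_) (ENat.natCast_lt_top n)
  by_contra! hc
  obtain ⟨B, hBA, hB⟩ := Set.exists_subset_encard_eq hc.le
  have hfin : B.Finite := Set.finite_of_encard_eq_coe hB
  have := hfin.fintype
  have hcard : Fintype.card B = n := by
    rw [Set.encard_eq_coe_toFinset_card, Set.toFinset_card] at hB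
    exact_mod_cast hB
  let e := (Fintype.equivFinOfCardEq hcard).symm
  obtain ⟨s, hs⟩ := hA
  refine hn (fun i => e i) (fun i => s ⟨e i, hBA (e i).2⟩) (fun i => (s _).2) fun σ => ?_
  obtain ⟨f, hf, hfs⟩ := hs {a | ∃ i, (e i : X) = a ∧ σ i = true} (by
    rintro a ⟨i, rfl, _⟩
    exact hBA (e i).2)
  have hmem : ∀ i, (∃ i', (e i' : X) = e i ∧ σ i' = true) ↔ σ i = true := by
    refine fun i => ⟨?_, fun h => ⟨i, rfl, h⟩⟩
    rintro ⟨i', h1, h2⟩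
    rwa [← e.injective (Subtype.ext h1)]
  refine ⟨f, hf, fun i => ?_⟩
  have h1 := hfs ⟨e i, hBA (e i).2⟩
  simp only [Set.mem_ofPred_eq, hmem] at h1
  exact ⟨h1.2, fun h => h1.1 (by simp [h])⟩

/-! ### Covers of subexponential size -/

-- Since `log² m = o(m)`, the power of two is eventually at most `exp (c * n / 2)`, which half of
-- the decay absorbs.
open Filter Topology in
lemma tendsto_two_pow_log_sq_mul_exp (d B : ℕ) (hB : 1 ≤ B) {c : ℝ} (hc : 0 < c) :
    Tendsto (fun n : ℕ => (((2 ^ (d * (Nat.log 2 (n * B + 1) + 2) ^ 2) : ℕ) : ℝ)) *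
      Real.exp (-(c * n))) atTop (𝓝 0) := by
  -- The little-o constant is tuned to the later bounds `(L + 2) ^ 2 ≤ 16 * log² m` and `m ≤ n * (B
  -- + 1)`, so that the exponent ends up at most `c / 2 * n`.
  have hκ : 0 < c / (2 * (16 * (d + 1) * (B + 1)) : ℝ) := by positivity
  have hlim : Tendsto (fun n : ℕ => ((n * B + 1 : ℕ) : ℝ)) atTop atTop := by
    refine tendsto_natCast_atTop_atTop.comp (tendsto_atTop_mono (fun n => ?_) tendsto_id)
    exact (Nat.le_mul_of_pos_right n hB).trans (Nat.le_succ _)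
  have h1 := hlim.eventually ((Real.isLittleO_pow_log_id_atTop (n := 2)).bound hκ)
  have h2 := hlim.eventually (eventually_ge_atTop (Real.exp 1))
  have h3 : Tendsto (fun n : ℕ => Real.exp (-(c / 2 * n))) atTop (𝓝 0) :=
    Real.tendsto_exp_neg_atTop_nhds_zero.comp
      (tendsto_natCast_atTop_atTop.const_mul_atTop (by positivity))
  refine squeeze_zero' (Eventually.of_forall fun n => by positivity) ?_ h3
  filter_upwards [h1, h2, eventually_ge_atTop 1] with n h1 h2 hn
  set m : ℕ := n * B + 1 with hm
  set L := Nat.log 2 m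
  have hm0 : (0 : ℝ) < m := by positivity
  have hl1 : 1 ≤ Real.log m := by
    rw [Real.le_log_iff_exp_le hm0]; exact h2
  have hL : (L : ℝ) ≤ 2 * Real.log m := by
    have : ((2 ^ L : ℕ) : ℝ) ≤ m := by exact_mod_cast Nat.pow_log_le_self 2 (by omega)
    have h4 := Real.log_le_log (by positivity) this
    push_cast at h4
    rw [Real.log_pow] at h4
    have h5 := Real.log_two_gt_d9
    have h6 : (L : ℝ) * (1 / 2) ≤ L * Real.log 2 :=
      mul_le_mul_of_nonneg_left (by linarith) (Nat.cast_nonneg _)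
    linarith
  have hL2 : ((L : ℝ) + 2) ^ 2 ≤ 16 * Real.log m ^ 2 := by
    have : (L : ℝ) + 2 ≤ 4 * Real.log m := by linarith
    calc ((L : ℝ) + 2) ^ 2 ≤ (4 * Real.log m) ^ 2 := pow_le_pow_left₀ (by positivity) this 2
      _ = _ := by ring
  simp only [id, Real.norm_eq_abs, abs_of_pos hm0, abs_of_nonneg (sq_nonneg (Real.log (m : ℝ)))] at h1
  have hmn : (m : ℝ) ≤ n * (B + 1) := by
    have : (1 : ℝ) ≤ n := by exact_mod_cast hn
    rw [hm]; push_cast; linarith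
  have hexp : (((2 ^ (d * (L + 2) ^ 2) : ℕ) : ℝ)) ≤ Real.exp (c / 2 * n) := by
    have h2e : (2 : ℝ) ≤ Real.exp 1 := by linarith [Real.exp_one_gt_d9]
    push_cast
    calc (2 : ℝ) ^ (d * (L + 2) ^ 2) ≤ Real.exp 1 ^ (d * (L + 2) ^ 2) :=
          pow_le_pow_left₀ zero_le_two h2e _
      _ = Real.exp (d * (L + 2 : ℝ) ^ 2) := by rw [← Real.exp_nat_mul]; push_cast; ring_nf
      _ ≤ Real.exp (c / 2 * n) := Real.exp_le_exp.2 ?_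
    have hK : c / (2 * (16 * (d + 1) * (B + 1)) : ℝ) * (16 * (d + 1) * (B + 1)) = c / 2 := by
      field_simp
    calc (d : ℝ) * (L + 2 : ℝ) ^ 2 ≤ (d + 1) * (16 * Real.log m ^ 2) := by gcongr; linarith
      _ ≤ (d + 1) * (16 * (c / (2 * (16 * (d + 1) * (B + 1)) : ℝ) * (n * (B + 1)))) := by
          gcongr
          exact h1.trans (mul_le_mul_of_nonneg_left hmn hκ.le)
      _ = c / (2 * (16 * (d + 1) * (B + 1)) : ℝ) * (16 * (d + 1) * (B + 1)) * n := by ring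
      _ = c / 2 * n := by rw [hK]
  calc _ ≤ Real.exp (c / 2 * n) * Real.exp (-(c * n)) :=
        mul_le_mul_of_nonneg_right hexp (Real.exp_pos _).le
    _ = Real.exp (-(c / 2 * n)) := by rw [← Real.exp_add]; congr 1; ring

/-- A maximal pairwise separated finite set. -/
lemma exists_maximal_separated {Y : Type*} [DecidableEq Y] (sep : Y → Y → Prop)
    (hsymm : ∀ p q, sep p q → sep q p) (K : ℕ)
    (hK : ∀ Q : Finset Y, (∀ p ∈ Q, ∀ q ∈ Q, p ≠ q → sep p q) → Q.card < K) :
    ∃ Q : Finset Y, Q.card < K ∧ ∀ y, y ∉ Q → ∃ q ∈ Q, ¬ sep y q := by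
  by_contra! hc
  have h : ∀ n, ∃ Q : Finset Y, (∀ p ∈ Q, ∀ q ∈ Q, p ≠ q → sep p q) ∧ Q.card = n := by
    intro n
    induction n with
    | zero => exact ⟨∅, by simp, rfl⟩
    | succ n ih =>
      obtain ⟨Q, hQ, rfl⟩ := ih
      obtain ⟨y, hy, hyQ⟩ := hc Q (hK Q hQ)
      refine ⟨insert y Q, fun p hp q hq hpq => ?_, Finset.card_insert_of_notMem hy⟩
      rcases Finset.mem_insert.1 hp with hp' | hp' <;>
        rcases Finset.mem_insert.1 hq with hq' | hq'
      · exact absurd (hp'.trans hq'.symm) hpq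
      · exact hp' ▸ hyQ q hq'
      · exact hq' ▸ hsymm _ _ (hyQ p hp')
      · exact hQ p hp' q hq' hpq
  obtain ⟨Q, hQ, hn⟩ := h K
  exact absurd (hK Q hQ) (by omega)

open Filter Topology in
/-- Families of finite fat-shattering dimension have uniform covers of subexponential size on
finite sets of points. -/
theorem exists_cover {X Y : Type*} [Nonempty Y] (h : Y → X → ℝ)
    (h_mem : ∀ y x, h y x ∈ Set.Icc (0 : ℝ) 1) (hfat : FiniteFatShattering (Set.range h))
    {η : ℝ} (hη : 0 < η) :
    ∃ C : ℕ → ℕ, (∀ c : ℝ, 0 < c →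
        Tendsto (fun n : ℕ => (C n : ℝ) * Real.exp (-(c * n))) atTop (𝓝 0)) ∧
      ∀ (ι : Type) [Fintype ι] (x : ι → X), ∃ Q : Finset Y, Q.card ≤ C (Fintype.card ι) ∧
        ∀ y, ∃ q ∈ Q, ∀ i, |h y (x i) - h q (x i)| ≤ η := by
  classical
  obtain ⟨b, hb⟩ := exists_nat_gt (max 1 (4 / η))
  have hb1 : (1 : ℝ) < b := (le_max_left _ _).trans_lt hb
  have hb0 : (0 : ℝ) < b := by linarith
  have hbη : 4 / (b : ℝ) < η := by
    rw [div_lt_iff₀ hb0, ← div_lt_iff₀' hη]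
    exact (le_max_right _ _).trans_lt hb
  obtain ⟨d, hd⟩ := exists_card_le_of_fatShatteringDim_lt_top (γ := 1 / b) (by positivity)
    (hfat (1 / b) (by positivity) (by rw [div_le_one hb0]; exact hb1.le))
  refine ⟨fun n => 2 ^ (d * (Nat.log 2 (n * (b + 1) + 1) + 2) ^ 2), fun c hc =>
    tendsto_two_pow_log_sq_mul_exp d (b + 1) (by omega) hc, fun ι _ x => ?_⟩
  rcases isEmpty_or_nonempty ι with hι | hι
  · obtain ⟨y⟩ := ‹Nonempty Y›
    exact ⟨{y}, by simpa using Nat.one_le_two_pow, fun _ => ⟨y, by simp, fun i => isEmptyElim i⟩⟩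
  -- A place is a point together with a grid level `k / b`; values within `1 / b` of the level are
  -- undecided. Shattering by these patterns is thus fat-shattering with margin `1 / b` and
  -- witnesses on the grid.
  let pos : Y → ι × Fin (b + 1) → Prop := fun y j => (j.2 : ℝ) / b + 1 / b ≤ h y (x j.1)
  let neg : Y → ι × Fin (b + 1) → Prop := fun y j => h y (x j.1) ≤ (j.2 : ℝ) / b - 1 / b
  have hb' : 0 < 1 / (b : ℝ) := by positivity
  have hdisj : ∀ y j, pos y j → neg y j → False := by
    intro y j h1 h2
    simp only [pos, neg] at h1 h2
    linarith
  have hcardJ : Fintype.card (ι × Fin (b + 1)) = Fintype.card ι * (b + 1) := by simp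
  have hJ : 1 ≤ Fintype.card (ι × Fin (b + 1)) := Fintype.card_pos
  let sep : Y → Y → Prop := fun p q => ∃ j, pos p j ∧ neg q j ∨ neg p j ∧ pos q j
  have hsh : ∀ Q T, PatternShatters pos neg Q T → T.card ≤ d := by
    intro Q T hT
    rw [← Fintype.card_coe]
    let e := Fintype.equivFin T
    rw [← Fintype.card_fin (Fintype.card T)]
    refine hd (Fin (Fintype.card T)) (fun t => x (e.symm t : ι × Fin (b + 1)).1)
      (fun t => ((e.symm t : ι × Fin (b + 1)).2 : ℝ) / b) (fun t => ⟨by positivity, ?_⟩) fun σ => ?_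
    · rw [div_le_one hb0]
      exact_mod_cast Nat.lt_succ_iff.1 (e.symm t : ι × Fin (b + 1)).2.2
    · obtain ⟨p, _, hp1, hp2⟩ := hT (T.filter fun j => ∃ t, (e.symm t : ι × Fin (b + 1)) = j ∧
        σ t = true) (Finset.filter_subset _ _)
      refine ⟨h p, ⟨p, rfl⟩, fun t => ⟨fun ht => ?_, fun ht => ?_⟩⟩
      · exact hp1 _ (Finset.mem_filter.2 ⟨(e.symm t).2, t, rfl, ht⟩)
      · refine hp2 _ (e.symm t).2 fun hmem => ?_
        obtain ⟨_, t', h1, h2⟩ := Finset.mem_filter.1 hmem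
        rw [e.symm.injective (Subtype.ext h1), ht] at h2
        exact absurd h2 (by simp)
  set N := Fintype.card ι * (b + 1) with hN
  set L := Nat.log 2 (N + 1) with hL
  have hNL : N + 1 < 2 ^ (L + 1) := Nat.lt_pow_succ_log_self (by norm_num) _
  have hcard : ∀ Q : Finset Y, (∀ p ∈ Q, ∀ q ∈ Q, p ≠ q → sep p q) →
      Q.card < 2 ^ (d * (L + 2) ^ 2) + 1 := by
    intro Q hQ
    -- For `d = 0` the bound to prove is `Q.card < 2`, and two separated patterns would already
    -- shatter a singleton.
    rcases Nat.eq_zero_or_pos d with rfl | hdpos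
    · have := card_lt_of_separated pos neg hdisj hJ 0 1 Q hQ (hsh Q) (by norm_num)
      by_contra! hc
      obtain ⟨p, hp, q, hq, hpq⟩ := Finset.one_lt_card.1 (show 1 < Q.card by
        simp only [zero_mul, pow_zero] at hc; omega)
      obtain ⟨j, hj⟩ := hQ p hp q hq hpq
      have hT : PatternShatters pos neg Q {j} := by
        intro E hE
        rcases Finset.subset_singleton_iff.1 hE with rfl | rfl
        · rcases hj with hj | hj
          · exact ⟨q, hq, by simp, by simpa using hj.2⟩
          · exact ⟨p, hp, by simp, by simpa using hj.1⟩
        · rcases hj with hj | hj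
          · exact ⟨p, hp, by simpa using hj.1, by simp⟩
          · exact ⟨q, hq, by simpa using hj.2, by simp⟩
      simpa using hsh Q _ hT
    · have := card_lt_of_separated pos neg hdisj hJ d (d * (L + 1)) Q hQ (hsh Q) (by
        rw [hcardJ, mul_comm d, pow_mul]
        exact Nat.pow_lt_pow_left hNL hdpos.ne')
      rw [hcardJ] at this
      refine this.trans_le (le_trans ?_ (Nat.le_succ _))
      calc (2 * N) ^ (d * (L + 1)) ≤ (2 ^ (L + 2)) ^ (d * (L + 1)) :=
            Nat.pow_le_pow_left (by rw [pow_succ]; omega) _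
        _ = 2 ^ ((L + 2) * (d * (L + 1))) := (pow_mul _ _ _).symm
        _ ≤ 2 ^ (d * (L + 2) ^ 2) := Nat.pow_le_pow_right (by norm_num) (by nlinarith)
  obtain ⟨Q, hQ, hQsep⟩ := exists_maximal_separated sep
    (fun p q ⟨j, hj⟩ => ⟨j, by tauto⟩) _ hcard
  have hclose : ∀ y q, ¬ sep y q → ∀ i, h y (x i) - h q (x i) ≤ η := by
    intro y q hyq i
    by_contra! hc
    have hg := h_mem q (x i)
    have hf := h_mem y (x i)
    set g := h q (x i)
    set f := h y (x i)
    -- The separating level is `(k + 1) / b` with `k = ⌈b * g⌉₊`: `g` lies at least a grid step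
    -- below it, and the gap of more than `4 / b` puts `f` at least a step above.
    have h1 := Nat.le_ceil ((b : ℝ) * g)
    have h2 := Nat.ceil_lt_add_one (mul_nonneg hb0.le hg.1)
    set k := ⌈(b : ℝ) * g⌉₊
    have h3 : (b : ℝ) * g + 4 < b * f := by
      have : 4 / (b : ℝ) < f - g := hbη.trans hc
      rw [div_lt_iff₀ hb0] at this
      linarith
    have h4 : (b : ℝ) * f ≤ b := mul_le_of_le_one_right hb0.le hf.2
    have h5 : (k : ℝ) + 1 < b := by linarith
    have h6 : k + 1 < b := by exact_mod_cast h5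
    refine hyq ⟨(i, ⟨k + 1, by omega⟩), Or.inl ⟨?_, ?_⟩⟩
    · simp only [pos]
      push_cast
      rw [← add_div, div_le_iff₀ hb0]
      linarith
    · simp only [neg]
      push_cast
      rw [← sub_div, le_div_iff₀ hb0]
      linarith
  refine ⟨Q, Nat.lt_succ_iff.1 hQ, fun y => ?_⟩
  by_cases hy : y ∈ Q
  · exact ⟨y, hy, fun i => by simpa using hη.le⟩
  · obtain ⟨q, hq, hyq⟩ := hQsep y hy
    refine ⟨q, hq, fun i => abs_le.2 ⟨?_, hclose y q hyq i⟩⟩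
    have := hclose q y (fun ⟨j, hj⟩ => hyq ⟨j, by tauto⟩) i
    linarith

/-! ### Finite dimension of mixtures and of the dual family -/

/-- Distribution function classes inherit finite fat-shattering dimension. -/
theorem FiniteFatShattering.distributionClass {X Y : Type*} [Nonempty Y] (h : Y → X → ℝ)
    (h_mem : ∀ y x, h y x ∈ Set.Icc (0 : ℝ) 1) (hfat : FiniteFatShattering (Set.range h)) :
    FiniteFatShattering (distributionClass h) := by
  classical
  intro γ hγ _
  obtain ⟨C, hC, hcov⟩ := exists_cover h h_mem hfat (half_pos hγ)
  obtain ⟨n, hn⟩ := ((hC (γ ^ 2 / 8) (by positivity)).eventually_lt_const one_pos).exists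
  refine fatShatteringDim_lt_top n fun x s hs hsh => ?_
  obtain ⟨Q, hQ, hQy⟩ := hcov (Fin n) x
  rw [Fintype.card_fin] at hQ
  -- The signed sum is affine in the function, so some `h y` does at least as well as the mixture;
  -- passing from `y` to the cover element costs half of the margin.
  have key : ∀ σ : Fin n → Bool, ∃ q ∈ Q, n * (γ / 2) ≤ ∑ i, sgn (σ i) * (h q (x i) - s i) := by
    intro σ
    obtain ⟨f, ⟨m, μ, hμ, hm, hf⟩, hfs⟩ := hsh σ
    have hint : ∀ i, Integrable (fun y => h y (x i)) μ := fun i =>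
      Integrable.of_mem_Icc 0 1 (hm (x i)).aemeasurable (ae_of_all _ fun y => h_mem y (x i))
    have hint' : ∀ i ∈ Finset.univ, Integrable (fun y => sgn (σ i) * (h y (x i) - s i)) μ :=
      fun i _ => ((hint i).sub (integrable_const _)).const_mul _
    have h1 : n * γ ≤ ∑ i, sgn (σ i) * (f (x i) - s i) := by
      have : ∀ i ∈ Finset.univ, γ ≤ sgn (σ i) * (f (x i) - s i) := by
        intro i _
        have := hfs i
        cases hσ : σ i
        · have := this.2 hσ
          simp only [sgn, Bool.false_eq_true, if_false]
          linarith
        · have := this.1 hσ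
          simp only [sgn, if_true]
          linarith
      simpa using Finset.card_nsmul_le_sum _ _ _ this
    have h2 : ∑ i, sgn (σ i) * (f (x i) - s i) = ∫ y, ∑ i, sgn (σ i) * (h y (x i) - s i) ∂μ := by
      rw [integral_finsetSum _ hint']
      refine Finset.sum_congr rfl fun i _ => ?_
      rw [integral_const_mul, integral_sub (hint i) (integrable_const _), hf]
      simp
    obtain ⟨y, hy⟩ := exists_integral_le (μ := μ)
      (f := fun y => ∑ i, sgn (σ i) * (h y (x i) - s i))
      (integrable_finsetSum _ hint')
    obtain ⟨q, hq, hqy⟩ := hQy y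
    refine ⟨q, hq, ?_⟩
    have h3 : ∑ i, sgn (σ i) * (h y (x i) - s i) - ∑ i, sgn (σ i) * (h q (x i) - s i) ≤
        n * (γ / 2) := by
      rw [← Finset.sum_sub_distrib]
      have : ∀ i ∈ Finset.univ, sgn (σ i) * (h y (x i) - s i) - sgn (σ i) * (h q (x i) - s i)
          ≤ γ / 2 := by
        intro i _
        rw [← mul_sub, sub_sub_sub_cancel_right]
        refine (le_abs_self _).trans ?_
        rw [abs_mul, abs_sgn, one_mul]
        exact hqy i
      simpa using Finset.sum_le_card_nsmul _ _ _ this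
    linarith
  -- The sign vectors served by `q`. Their number is controlled by Hoeffding with `τ = γ / 2`, and
  -- `n` was chosen so that the cover cannot serve all `2 ^ n` of them.
  let S : Y → Finset (Fin n → Bool) := fun q =>
    Finset.univ.filter fun σ => n * (γ / 2) ≤ ∑ i, sgn (σ i) * (h q (x i) - s i)
  have hS : ∀ q, ((S q).card : ℝ) ≤ 2 ^ n * Real.exp (-(γ ^ 2 / 8 * n)) := by
    intro q
    have := card_sgn_sum_ge_le (fun i => h q (x i) - s i) one_pos (half_pos hγ).le
      (fun i => by
        have h1 := h_mem q (x i)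
        have h2 := hs i
        exact abs_le.2 ⟨by linarith [h1.1, h2.2], by linarith [h1.2, h2.1]⟩) (S q)
      (fun σ hσ => by simpa using (Finset.mem_filter.1 hσ).2)
    rw [Fintype.card_fin] at this
    refine this.trans_eq ?_
    congr 2
    ring
  have hU : (Finset.univ : Finset (Fin n → Bool)) ⊆ Q.biUnion S := by
    intro σ _
    obtain ⟨q, hq, h1⟩ := key σ
    exact Finset.mem_biUnion.2 ⟨q, hq, Finset.mem_filter.2 ⟨Finset.mem_univ _, h1⟩⟩
  have h1 : (2 : ℝ) ^ n ≤ ∑ q ∈ Q, ((S q).card : ℝ) := by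
    have := (Finset.card_le_card hU).trans Finset.card_biUnion_le
    rw [Finset.card_univ, Fintype.card_fun, Fintype.card_bool, Fintype.card_fin] at this
    exact_mod_cast this
  have h2 := h1.trans (Finset.sum_le_card_nsmul _ _ _ fun q _ => hS q)
  rw [nsmul_eq_mul] at h2
  have h3 : (Q.card : ℝ) * (2 ^ n * Real.exp (-(γ ^ 2 / 8 * n))) ≤
      2 ^ n * (C n * Real.exp (-(γ ^ 2 / 8 * n))) := by
    have : (Q.card : ℝ) ≤ C n := by exact_mod_cast hQ
    calc _ ≤ (C n : ℝ) * (2 ^ n * Real.exp (-(γ ^ 2 / 8 * n))) := by gcongr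
      _ = _ := by ring
  have h4 : (2 : ℝ) ^ n * (C n * Real.exp (-(γ ^ 2 / 8 * n))) < 2 ^ n * 1 :=
    mul_lt_mul_of_pos_left hn (by positivity)
  linarith

/-- The dual family inherits finite fat-shattering dimension. -/
theorem FiniteFatShattering.dualFamily {X Y : Type*} (h : Y → X → ℝ)
    (hfat : FiniteFatShattering (Set.range h)) :
    FiniteFatShattering (Set.range (dualFamily h)) := by
  classical
  intro γ hγ hγ1
  obtain ⟨d, hd⟩ := exists_card_le_of_fatShatteringDim_lt_top (γ := γ / 2) (by positivity)
    (hfat (γ / 2) (by positivity) (by linarith))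
  obtain ⟨M, hM⟩ := exists_nat_gt (2 / γ)
  have hM0 : (0 : ℝ) < M := lt_trans (by positivity) hM
  have hMγ : 1 / (M : ℝ) < γ / 2 := by
    rw [div_lt_iff₀ hM0]
    rw [div_lt_iff₀ hγ] at hM
    linarith
  -- Rounding the witnesses down to multiples of `1 / M` costs at most half of the margin. By
  -- pigeonhole on the `M + 1` values, `2 ^ (d + 1)` of the points share a level, enough to be
  -- indexed by the sign vectors of length `d + 1`.
  refine fatShatteringDim_lt_top ((M + 1) * 2 ^ (d + 1)) fun y s hs hsh => ?_
  obtain ⟨j, hj, hcard⟩ := Finset.exists_le_card_fiber_of_mul_le_card_of_maps_to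
    (s := (Finset.univ : Finset (Fin ((M + 1) * 2 ^ (d + 1))))) (t := Finset.range (M + 1))
    (f := fun i => ⌊(M : ℝ) * s i⌋₊) (n := 2 ^ (d + 1)) (fun i _ => by
      rw [Finset.mem_range, Nat.lt_succ_iff]
      exact Nat.floor_le_of_le (mul_le_of_le_one_right hM0.le (hs i).2)) (by simp) (by simp)
  set G := Finset.univ.filter fun i => ⌊(M : ℝ) * s i⌋₊ = j
  have hemb : Fintype.card (Fin (d + 1) → Bool) ≤ Fintype.card G := by
    simpa using hcard
  obtain ⟨e⟩ := Function.Embedding.nonempty_of_card_le hemb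
  have hc : ∀ i ∈ G, |s i - j / M| ≤ γ / 2 := by
    intro i hi
    have hij : ⌊(M : ℝ) * s i⌋₊ = j := (Finset.mem_filter.1 hi).2
    have h1 := Nat.floor_le (mul_nonneg hM0.le (hs i).1)
    have h2 := Nat.lt_floor_add_one ((M : ℝ) * s i)
    rw [hij] at h1 h2
    have h3 : (j : ℝ) / M ≤ s i := by rw [div_le_iff₀ hM0]; linarith
    have h4 : s i < j / M + 1 / M := by rw [← add_div, lt_div_iff₀ hM0]; linarith
    rw [abs_le]
    constructor <;> linarith
  -- Assouad's duality: `x k` cuts out the indices `σ` with `σ k = true`. Read the other way, `h (y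
  -- (e σ))` realizes `σ` on the `d + 1` points `x k`.
  have hx : ∀ k : Fin (d + 1), ∃ x, ∀ σ : Fin (d + 1) → Bool,
      (σ k = true → (j : ℝ) / M + γ / 2 ≤ h (y (e σ)) x) ∧
      (σ k = false → h (y (e σ)) x ≤ (j : ℝ) / M - γ / 2) := by
    intro k
    obtain ⟨_, ⟨x, rfl⟩, hx⟩ := hsh fun i => decide (∃ σ, (e σ : Fin _) = i ∧ σ k = true)
    refine ⟨x, fun σ => ?_⟩
    have h1 := hx (e σ)
    have h2 := abs_le.1 (hc (e σ) (e σ).2)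
    have h3 : (∃ σ', (e σ' : Fin ((M + 1) * 2 ^ (d + 1))) = e σ ∧ σ' k = true) ↔ σ k = true := by
      refine ⟨?_, fun h => ⟨σ, rfl, h⟩⟩
      rintro ⟨σ', h4, h5⟩
      rwa [← e.injective (Subtype.ext h4)]
    simp only [h3, HypothesisClass.dualFamily, decide_eq_true_eq, decide_eq_false_iff_not,
      Bool.not_eq_true] at h1
    exact ⟨fun h => by linarith [h1.1 h], fun h => by linarith [h1.2 h]⟩
  choose x hx using hx
  have := hd (Fin (d + 1)) x (fun _ => (j : ℝ) / M) (fun _ => ⟨by positivity, by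
    rw [div_le_one hM0]
    exact_mod_cast Nat.lt_succ_iff.1 (Finset.mem_range.1 hj)⟩) fun σ =>
      ⟨h (y (e σ)), ⟨_, rfl⟩, fun i => hx i σ⟩
  simp at this

/-! ### Uniform deviations by symmetrization -/

/-- Average over signs of a supremum of signed sums, for a family with a small cover. -/
lemma sum_iSup_abs_sgn_sum_le {K ι : Type*} [Nonempty K] [Fintype ι] [DecidableEq ι]
    (a : K → ι → ℝ) (ha : ∀ k i, |a k i| ≤ 2) {ρ τ : ℝ} (hτ : 0 ≤ τ) (Q : Finset K)
    (hQ : ∀ k, ∃ q ∈ Q, ∀ i, |a k i - a q i| ≤ ρ) :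
    ∑ σ : ι → Bool, ⨆ k, |∑ i, sgn (σ i) * a k i| ≤
      2 ^ Fintype.card ι * (Fintype.card ι *
        (ρ + τ + 4 * Q.card * Real.exp (-(Fintype.card ι * τ ^ 2 / 8)))) := by
  classical
  set n := Fintype.card ι with hn
  let S : K → Bool → Finset (ι → Bool) := fun q b =>
    Finset.univ.filter fun σ => n * τ ≤ ∑ i, sgn (σ i) * (sgn b * a q i)
  have hS : ∀ q b, ((S q b).card : ℝ) ≤ 2 ^ n * Real.exp (-(n * τ ^ 2 / 8)) := by
    intro q b
    have := card_sgn_sum_ge_le (fun i => sgn b * a q i) two_pos hτ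
      (fun i => by rw [abs_mul, abs_sgn, one_mul]; exact ha q i) (S q b)
      (fun σ hσ => (Finset.mem_filter.1 hσ).2)
    norm_num at this ⊢
    exact this
  -- Exceptional sign vectors, with both orientations `b` because of the absolute value. Off `U` the
  -- supremum is at most `n * (ρ + τ)`; on `U` the trivial bound `2 * n` is used.
  set U := (Q ×ˢ Finset.univ).biUnion fun p => S p.1 p.2 with hU
  have hUc : (U.card : ℝ) ≤ 2 * Q.card * (2 ^ n * Real.exp (-(n * τ ^ 2 / 8))) := by
    have h1 : (U.card : ℝ) ≤ ∑ p ∈ Q ×ˢ (Finset.univ : Finset Bool), ((S p.1 p.2).card : ℝ) := by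
      exact_mod_cast Finset.card_biUnion_le
    refine h1.trans ((Finset.sum_le_card_nsmul _ _ _ fun p _ => hS p.1 p.2).trans_eq ?_)
    rw [nsmul_eq_mul, Finset.card_product, Finset.card_univ, Fintype.card_bool]
    push_cast
    ring
  have hterm : ∀ (σ : ι → Bool) k i, |sgn (σ i) * a k i| ≤ 2 := by
    intro σ k i
    rw [abs_mul, abs_sgn, one_mul]
    exact ha k i
  have hsup : ∀ σ : ι → Bool, ⨆ k, |∑ i, sgn (σ i) * a k i| ≤
      n * (ρ + τ) + if σ ∈ U then (2 * n : ℝ) else 0 := by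
    intro σ
    refine ciSup_le fun k => ?_
    obtain ⟨q, hq, hqk⟩ := hQ k
    -- The sign of `ρ` is not prescribed: the cover forces `0 ≤ ρ` when there is an index, and
    -- otherwise `n = 0`.
    have hρ : 0 ≤ n * ρ := by
      rcases isEmpty_or_nonempty ι with h | ⟨⟨i⟩⟩
      · simp [hn]
      · exact mul_nonneg (Nat.cast_nonneg _) ((abs_nonneg _).trans (hqk i))
    split_ifs with hσ
    · have h1 : |∑ i, sgn (σ i) * a k i| ≤ 2 * n := by
        refine (Finset.abs_sum_le_sum_abs _ _).trans
          ((Finset.sum_le_card_nsmul _ _ _ fun i _ => hterm σ k i).trans_eq ?_)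
        rw [nsmul_eq_mul, Finset.card_univ, mul_comm]
      have h2 : 0 ≤ n * τ := by positivity
      linarith
    · have h1 : |∑ i, sgn (σ i) * a k i - ∑ i, sgn (σ i) * a q i| ≤ n * ρ := by
        rw [← Finset.sum_sub_distrib]
        refine (Finset.abs_sum_le_sum_abs _ _).trans
          ((Finset.sum_le_card_nsmul _ _ ρ fun i _ => ?_).trans_eq ?_)
        · rw [← mul_sub, abs_mul, abs_sgn, one_mul]
          exact hqk i
        · rw [nsmul_eq_mul, Finset.card_univ]
      have h2 : ∀ b, ∑ i, sgn (σ i) * (sgn b * a q i) < n * τ := by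
        intro b
        by_contra! hc
        exact hσ (Finset.mem_biUnion.2 ⟨(q, b), by simp [hq],
          Finset.mem_filter.2 ⟨Finset.mem_univ _, hc⟩⟩)
      have h3 := h2 true
      have h4 := h2 false
      simp only [sgn, Bool.false_eq_true, if_true, if_false, one_mul, neg_one_mul, mul_neg,
        Finset.sum_neg_distrib] at h3 h4
      have h5 := abs_le.1 h1
      simp only [sgn] at h5 ⊢
      rw [abs_le]
      constructor <;> linarith [h5.1, h5.2]
  refine (Finset.sum_le_sum fun σ _ => hsup σ).trans ?_
  rw [Finset.sum_add_distrib, Finset.sum_const, Finset.card_univ, Fintype.card_fun,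
    Fintype.card_bool, ← Finset.sum_filter, Finset.sum_const, Finset.filter_mem_eq_inter,
    Finset.univ_inter, nsmul_eq_mul, nsmul_eq_mul]
  push_cast
  have h1 := mul_le_mul_of_nonneg_right hUc (show (0 : ℝ) ≤ 2 * n by positivity)
  rw [← hn]
  nlinarith

lemma bddAbove_range_abs {K : Type*} {g : K → ℝ} {B : ℝ} (h : ∀ k, |g k| ≤ B) :
    BddAbove (Set.range fun k => |g k|) :=
  ⟨B, by rintro _ ⟨k, rfl⟩; exact h k⟩

/-- Expected uniform deviation of a bounded countable family with small covers. -/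
theorem integral_iSup_abs_deviation_le {Z K : Type*} [MeasurableSpace Z] [Countable K] [Nonempty K]
    (P : Measure Z) [IsProbabilityMeasure P] (φ : K → Z → ℝ) (hφ : ∀ k, Measurable (φ k))
    (hb : ∀ k z, |φ k z| ≤ 1) (n N : ℕ) {ρ τ : ℝ} (hτ : 0 ≤ τ)
    (hcov : ∀ w : Fin n ⊕ Fin n → Z, ∃ Q : Finset K, Q.card ≤ N ∧
      ∀ k, ∃ q ∈ Q, ∀ i, |φ k (w i) - φ q (w i)| ≤ ρ) :
    ∫ z, ⨆ k, |n * ∫ u, φ k u ∂P - ∑ i, φ k (z i)| ∂(Measure.pi fun _ : Fin n => P) ≤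
      n * (2 * ρ + τ + 4 * N * Real.exp (-(n * τ ^ 2 / 8))) := by
  set κ := Measure.pi fun _ : Fin n => P
  let a : (Fin n → Z × Z) → K → Fin n → ℝ := fun w k i => φ k (w i).1 - φ k (w i).2
  have ha : ∀ w k i, |a w k i| ≤ 2 := fun w k i =>
    (abs_sub _ _).trans (by linarith [hb k (w i).1, hb k (w i).2])
  have ham : ∀ k i, Measurable fun w => a w k i := fun k i =>
    ((hφ k).comp (measurable_fst.comp (measurable_pi_apply i))).sub
      ((hφ k).comp (measurable_snd.comp (measurable_pi_apply i)))
  let S : (Fin n → Bool) → (Fin n → Z × Z) → ℝ := fun σ w => ⨆ k, |∑ i, sgn (σ i) * a w k i|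
  have hterm : ∀ (σ : Fin n → Bool) w k, |∑ i, sgn (σ i) * a w k i| ≤ 2 * n := by
    intro σ w k
    refine (Finset.abs_sum_le_sum_abs _ _).trans
      ((Finset.sum_le_card_nsmul _ _ 2 fun i _ => ?_).trans_eq ?_)
    · rw [abs_mul, abs_sgn, one_mul]
      exact ha w k i
    · rw [nsmul_eq_mul, Finset.card_univ, Fintype.card_fin, mul_comm]
  have hSm : ∀ σ, Measurable (S σ) := fun σ => Measurable.iSup fun k => by
    have : Measurable fun w => ∑ i, sgn (σ i) * a w k i :=
      Finset.measurable_sum _ fun i _ => (ham k i).const_mul _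
    exact this.abs
  have hS0 : ∀ σ w, 0 ≤ S σ w := fun σ w => Real.iSup_nonneg fun k => abs_nonneg _
  have hS2 : ∀ σ w, S σ w ≤ 2 * n := fun σ w => ciSup_le (hterm σ w)
  let ν := Measure.pi fun _ : Fin n => P.prod P
  have hSi : ∀ σ, Integrable (S σ) ν := fun σ =>
    Integrable.of_mem_Icc 0 (2 * n) (hSm σ).aemeasurable (ae_of_all _ fun w => ⟨hS0 σ w, hS2 σ w⟩)
  let D : (Fin n → Z × Z) → ℝ := S fun _ => true
  -- Exchanging a sample point with its ghost preserves the law and flips the sign of that term, so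
  -- the expectation does not depend on `σ` and may be averaged over all `σ`.
  have hswap : ∀ σ, ∫ w, S σ w ∂ν = ∫ w, D w ∂ν := by
    intro σ
    let T : Fin n → Z × Z → Z × Z := fun i => if σ i then id else Prod.swap
    have hT : ∀ i, MeasurePreserving (T i) (P.prod P) (P.prod P) := by
      intro i
      cases hσ : σ i
      · simp only [T, hσ]
        exact Measure.measurePreserving_swap
      · simp only [T, hσ]
        exact MeasurePreserving.id _
    have hTp : MeasurePreserving (fun (w : Fin n → Z × Z) i => T i (w i)) ν ν :=
      measurePreserving_pi _ _ hT
    rw [← hTp.map_eq, integral_map hTp.measurable.aemeasurable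
      (hTp.map_eq.symm ▸ (hSm _).aestronglyMeasurable), hTp.map_eq]
    refine integral_congr_ae (ae_of_all _ fun w => ?_)
    refine iSup_congr fun k => ?_
    congr 1
    refine Finset.sum_congr rfl fun i _ => ?_
    cases hσ : σ i <;> simp [T, hσ, a, sgn]
  have hcard : Fintype.card (Fin n → Bool) = 2 ^ n := by simp
  have hsum : ∀ w, ∑ σ, S σ w ≤ 2 ^ n * (n * (2 * ρ + τ + 4 * N * Real.exp (-(n * τ ^ 2 / 8)))) := by
    intro w
    obtain ⟨Q, hQN, hQ⟩ := hcov (Sum.elim (fun i => (w i).1) (fun i => (w i).2))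
    have := sum_iSup_abs_sgn_sum_le (a w) (ha w) (ρ := 2 * ρ) hτ Q (fun k => by
      obtain ⟨q, hq, hqk⟩ := hQ k
      refine ⟨q, hq, fun i => ?_⟩
      have h1 := hqk (Sum.inl i)
      have h2 := hqk (Sum.inr i)
      simp only [Sum.elim_inl, Sum.elim_inr] at h1 h2
      have h3 : a w k i - a w q i =
        (φ k (w i).1 - φ q (w i).1) - (φ k (w i).2 - φ q (w i).2) := by simp only [a]; ring
      rw [h3]
      exact (abs_sub _ _).trans (by linarith))
    rw [Fintype.card_fin] at this
    refine this.trans ?_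
    have : (Q.card : ℝ) ≤ N := by exact_mod_cast hQN
    gcongr
  have hD : ∫ w, D w ∂ν ≤ n * (2 * ρ + τ + 4 * N * Real.exp (-(n * τ ^ 2 / 8))) := by
    have h1 : ∫ w, ∑ σ, S σ w ∂ν = 2 ^ n * ∫ w, D w ∂ν := by
      rw [integral_finsetSum _ fun σ _ => hSi σ]
      simp_rw [hswap]
      rw [Finset.sum_const, Finset.card_univ, hcard, nsmul_eq_mul]
      push_cast
      rfl
    have h2 := integral_mono (μ := ν) (integrable_finsetSum _ fun σ _ => hSi σ)
      (integrable_const _) hsum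
    rw [h1, integral_const, probReal_univ, one_smul] at h2
    exact le_of_mul_le_mul_left h2 (by positivity)
  let D' : (Fin n → Z) × (Fin n → Z) → ℝ := fun p => ⨆ k, |∑ i, (φ k (p.1 i) - φ k (p.2 i))|
  have hsum2 : ∀ u v : Fin n → Z, ∀ k, |∑ i, (φ k (u i) - φ k (v i))| ≤ 2 * n := by
    intro u v k
    simpa [a, sgn] using hterm (fun _ => true) (fun i => (u i, v i)) k
  have hD'm : Measurable D' := Measurable.iSup fun k => by
    have : Measurable fun p : (Fin n → Z) × (Fin n → Z) => ∑ i, (φ k (p.1 i) - φ k (p.2 i)) :=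
      Finset.measurable_sum _ fun i _ =>
        ((hφ k).comp ((measurable_pi_apply i).comp measurable_fst)).sub
          ((hφ k).comp ((measurable_pi_apply i).comp measurable_snd))
    exact this.abs
  have hD'b : ∀ p, D' p ∈ Set.Icc (0 : ℝ) (2 * n) := fun p =>
    ⟨Real.iSup_nonneg fun k => abs_nonneg _, ciSup_le (hsum2 p.1 p.2)⟩
  have hD'i : Integrable D' (κ.prod κ) :=
    Integrable.of_mem_Icc 0 (2 * n) hD'm.aemeasurable (ae_of_all _ hD'b)
  have hDD' : ∫ w, D w ∂ν = ∫ u, (∫ v, D' (u, v) ∂κ) ∂κ := by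
    have hmp := measurePreserving_arrowProdEquivProdArrow Z Z (Fin n) (fun _ => P) (fun _ => P)
    rw [← integral_prod _ hD'i, ← hmp.integral_comp' D']
    refine integral_congr_ae (ae_of_all _ fun w => ?_)
    refine iSup_congr fun k => ?_
    congr 1
    refine Finset.sum_congr rfl fun i _ => ?_
    simp [a, sgn, MeasurableEquiv.arrowProdEquivProdArrow, Equiv.arrowProdEquivProdArrow]
  refine le_trans ?_ (hDD'.symm.trans_le hD)
  have hφi : ∀ k i, Integrable (fun v : Fin n → Z => φ k (v i)) κ := fun k i =>
    Integrable.of_mem_Icc (-1) 1 ((hφ k).comp (measurable_pi_apply i)).aemeasurable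
      (ae_of_all _ fun v => abs_le.1 (hb k (v i)))
  have hD's : ∀ u, Integrable (fun v => D' (u, v)) κ := fun u =>
    Integrable.of_mem_Icc 0 (2 * n) (hD'm.comp measurable_prodMk_left).aemeasurable
      (ae_of_all _ fun v => hD'b (u, v))
  refine integral_mono_of_nonneg (ae_of_all _ fun z => Real.iSup_nonneg fun k => abs_nonneg _)
    hD'i.integral_prod_left (ae_of_all _ fun u => ciSup_le fun k => ?_)
  -- The true mean is the expectation over a ghost sample `v`; the supremum is then moved inside
  -- that expectation.
  have h1 : n * ∫ u, φ k u ∂P - ∑ i, φ k (u i) = -∫ v, ∑ i, (φ k (u i) - φ k (v i)) ∂κ := by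
    have hi : ∀ i ∈ Finset.univ, Integrable (fun v : Fin n → Z => φ k (u i) - φ k (v i)) κ :=
      fun i _ => (integrable_const _).sub (hφi k i)
    rw [integral_finsetSum _ hi]
    have : ∀ i, ∫ v, (φ k (u i) - φ k (v i)) ∂κ = φ k (u i) - ∫ u, φ k u ∂P := by
      intro i
      rw [integral_sub (integrable_const _) (hφi k i),
        integral_comp_eval (μ := fun _ : Fin n => P) (hφ k).aestronglyMeasurable]
      simp [κ]
    simp [this]
  rw [h1, abs_neg]
  refine (abs_integral_le_integral_abs).trans (integral_mono_of_nonneg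
    (ae_of_all _ fun _ => abs_nonneg _) (hD's u) (ae_of_all _ fun v => ?_))
  exact le_ciSup (bddAbove_range_abs (hsum2 u v)) k

/-! ### Discrete mixing measures and products of residuals -/

lemma abs_integral_le_of_abs_le {α : Type*} [MeasurableSpace α] (μ : Measure α)
    [IsProbabilityMeasure μ] {f : α → ℝ} {C : ℝ} (h : ∀ a, |f a| ≤ C) : |∫ a, f a ∂μ| ≤ C := by
  have := norm_integral_le_of_norm_le_const (μ := μ) (f := f) (C := C) (ae_of_all _ h)
  rwa [probReal_univ, mul_one] at this

lemma exists_integral_eq_integral_comp {X Y W : Type*} {m : MeasurableSpace Y}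
    {m' : MeasurableSpace W} (μ : Measure Y) [IsProbabilityMeasure μ] {r : Y → W}
    (hr : Measurable r) (k : W → X → ℝ) (hk : ∀ x, Measurable fun w => k w x) :
    ∃ ν : Measure W, IsProbabilityMeasure ν ∧ ∀ x, ∫ w, k w x ∂ν = ∫ y, k (r y) x ∂μ := by
  exact ⟨μ.map r, Measure.isProbabilityMeasure_map hr.aemeasurable, fun x =>
    integral_map hr.aemeasurable (hk x).aestronglyMeasurable⟩

/-- On a countable index set the mixing measure may be taken on the discrete σ-algebra. -/
lemma exists_discrete_of_mem_distributionClass {X Y : Type*} [Countable Y] {h : Y → X → ℝ}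
    {f : X → ℝ} (hf : f ∈ distributionClass h) :
    ∃ ν : @Measure Y ⊤, IsProbabilityMeasure ν ∧ ∀ x, f x = ∫ y, h y x ∂ν := by
  classical
  obtain ⟨m, μ, hμ, hm, hf⟩ := hf
  have hr : ∀ y, ∃ y', h y' = h y := fun y => ⟨y, rfl⟩
  -- The given σ-algebra need not contain singletons. Choosing one index per distinct function `h y`
  -- gives a map `r` that is measurable into the discrete σ-algebra and does not change `h`.
  let g : (X → ℝ) → Y := fun u => if hu : ∃ y, h y = u then hu.choose else
    Classical.choice (by
      have := nonempty_of_isProbabilityMeasure μ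
      exact this)
  let r : Y → Y := fun y => g (h y)
  have hhr : ∀ y, h (r y) = h y := by
    intro y
    simp only [r, g, dif_pos (hr y)]
    exact (hr y).choose_spec
  have hcls : ∀ y₀, MeasurableSet[m] {y | h y = h y₀} := by
    intro y₀
    have : ∀ y' : {y' // h y' ≠ h y₀}, ∃ x, h y' x ≠ h y₀ x := fun y' => Function.ne_iff.1 y'.2
    choose x hx using this
    -- By countability of `Y`, one distinguishing point for each index outside the class suffices,
    -- so the class is a countable intersection.
    have heq : {y | h y = h y₀} = ⋂ y', {y | h y (x y') = h y₀ (x y')} := by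
      ext y
      simp only [Set.mem_ofPred_eq, Set.mem_iInter]
      refine ⟨fun h y' => by rw [h], fun h => ?_⟩
      by_contra hne
      exact hx ⟨y, hne⟩ (h ⟨y, hne⟩)
    rw [heq]
    exact MeasurableSet.iInter fun y' => hm (x y') (measurableSet_singleton _)
  have hrm : @Measurable Y Y m ⊤ r := by
    refine @measurable_to_countable' Y Y ⊤ _ m r fun y₀ => ?_
    by_cases hy : r y₀ = y₀
    · have : r ⁻¹' {y₀} = {y | h y = h y₀} := by
        ext y
        simp only [Set.mem_preimage, Set.mem_singleton_iff, Set.mem_ofPred_eq]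
        refine ⟨fun h1 => by rw [← hhr y, h1], fun h1 => ?_⟩
        rw [← hy]
        simp only [r, h1]
      rw [this]
      exact hcls y₀
    · have : r ⁻¹' {y₀} = ∅ := by
        ext y
        simp only [Set.mem_preimage, Set.mem_singleton_iff, Set.mem_empty_iff_false, iff_false]
        intro h1
        apply hy
        have h2 : h y₀ = h y := by rw [← hhr y, h1]
        rw [← h1]
        simp only [r, h1]
        simp only [r, h2] at h1 ⊢
        exact h1
      rw [this]
      exact MeasurableSet.empty
  obtain ⟨ν, hν, hνx⟩ := @exists_integral_eq_integral_comp X Y Y m ⊤ μ hμ r hrm h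
    fun _ => measurable_from_top
  exact ⟨ν, hν, fun x => by rw [hf, hνx]; simp only [hhr]⟩

lemma mem_distributionClass {X Y : Type*} (h : Y → X → ℝ) (y : Y) : h y ∈ distributionClass h := by
  let _ : MeasurableSpace Y := ⊤
  exact ⟨⊤, Measure.dirac y, inferInstance, fun x => measurable_from_top, fun x => by simp⟩

/-- The product of the residuals of two members of the family at a labelled point. -/
def residualProd {X Y : Type*} (h : Y → X → ℝ) (p : Y × Y) (z : X × Set.Icc (0 : ℝ) 1) : ℝ :=
  (h p.1 z.1 - z.2) * (h p.2 z.1 - z.2)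

lemma abs_residual_le {X Y : Type*} {h : Y → X → ℝ} (h_mem : ∀ y x, h y x ∈ Set.Icc (0 : ℝ) 1)
    (y : Y) (z : X × Set.Icc (0 : ℝ) 1) : |h y z.1 - z.2| ≤ 1 := by
  have h1 := h_mem y z.1
  have h2 := z.2.2
  exact abs_le.2 ⟨by linarith [h1.1, h2.2], by linarith [h1.2, h2.1]⟩

lemma abs_residualProd_le {X Y : Type*} {h : Y → X → ℝ}
    (h_mem : ∀ y x, h y x ∈ Set.Icc (0 : ℝ) 1) (p : Y × Y) (z : X × Set.Icc (0 : ℝ) 1) :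
    |residualProd h p z| ≤ 1 := by
  rw [residualProd, abs_mul]
  exact mul_le_one₀ (abs_residual_le h_mem _ _) (abs_nonneg _) (abs_residual_le h_mem _ _)

lemma measurable_residualProd {X Y : Type*} [MeasurableSpace X] {h : Y → X → ℝ}
    (hm : ∀ y, Measurable (h y)) (p : Y × Y) : Measurable (residualProd h p) :=
  (((hm p.1).comp measurable_fst).sub (measurable_subtype_coe.comp measurable_snd)).mul
    (((hm p.2).comp measurable_fst).sub (measurable_subtype_coe.comp measurable_snd))

lemma abs_residualProd_deviation_le {X Y : Type*} [MeasurableSpace X] {h : Y → X → ℝ}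
    (h_mem : ∀ y x, h y x ∈ Set.Icc (0 : ℝ) 1) (P : Measure (X × Set.Icc (0 : ℝ) 1))
    [IsProbabilityMeasure P] (p : Y × Y) {n : ℕ} (z : Fin n → X × Set.Icc (0 : ℝ) 1) :
    |n * ∫ u, residualProd h p u ∂P - ∑ i, residualProd h p (z i)| ≤ 2 * n := by
  have hb := abs_residualProd_le h_mem
  have h1 := abs_integral_le_of_abs_le P (hb p)
  have h2 : |∑ i, residualProd h p (z i)| ≤ n := by
    refine (Finset.abs_sum_le_sum_abs _ _).trans
      ((Finset.sum_le_card_nsmul _ _ 1 fun i _ => hb p (z i)).trans_eq ?_)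
    simp
  refine (abs_sub _ _).trans ?_
  rw [abs_mul, Nat.abs_cast]
  nlinarith [Nat.cast_nonneg (α := ℝ) n]

/-- The uniform deviation of residual products bounds the deviation of squared losses over the
distribution function class. -/
lemma abs_expLoss_sub_sum_le {X Y : Type*} [Countable Y] [MeasurableSpace X] {h : Y → X → ℝ}
    (h_mem : ∀ y x, h y x ∈ Set.Icc (0 : ℝ) 1) (hm : ∀ y, Measurable (h y))
    (P : Measure (X × Set.Icc (0 : ℝ) 1)) [IsProbabilityMeasure P] {f : X → ℝ}
    (hf : f ∈ distributionClass h) (n : ℕ) (z : Fin n → X × Set.Icc (0 : ℝ) 1) :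
    |n * expLoss P f - ∑ i, (f (z i).1 - (z i).2) ^ 2| ≤
      ⨆ p, |n * ∫ u, residualProd h p u ∂P - ∑ i, residualProd h p (z i)| := by
  obtain ⟨ν, hν, hfν⟩ := exists_discrete_of_mem_distributionClass hf
  let _ : MeasurableSpace Y := ⊤
  have hφm := measurable_residualProd hm
  have hb := abs_residualProd_le h_mem
  have hint : ∀ x, Integrable (fun y => h y x) ν := fun x =>
    Integrable.of_mem_Icc 0 1 measurable_from_top.aemeasurable (ae_of_all _ fun y => h_mem y x)
  -- The square of a mean is the mean of the product over two independent copies.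
  have hsq : ∀ u : X × Set.Icc (0 : ℝ) 1,
      (f u.1 - u.2) ^ 2 = ∫ p, residualProd h p u ∂(ν.prod ν) := by
    intro u
    have h1 : f u.1 - u.2 = ∫ y, (h y u.1 - u.2) ∂ν := by
      rw [integral_sub (hint _) (integrable_const _), hfν]
      simp
    rw [sq, h1, ← integral_prod_mul]
    rfl
  have hjoint : Measurable fun q : (X × Set.Icc (0 : ℝ) 1) × (Y × Y) => residualProd h q.2 q.1 :=
    measurable_from_prod_countable_left hφm
  have hji : Integrable (fun q : (X × Set.Icc (0 : ℝ) 1) × (Y × Y) => residualProd h q.2 q.1)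
      (P.prod (ν.prod ν)) :=
    Integrable.of_mem_Icc (-1) 1 hjoint.aemeasurable (ae_of_all _ fun q => abs_le.1 (hb q.2 q.1))
  have hz : ∀ i, Integrable (fun p => residualProd h p (z i)) (ν.prod ν) := fun i =>
    Integrable.of_mem_Icc (-1) 1 (hjoint.comp measurable_prodMk_left).aemeasurable
      (ae_of_all _ fun p => abs_le.1 (hb p (z i)))
  have hL : expLoss P f = ∫ p, ∫ u, residualProd h p u ∂P ∂(ν.prod ν) := by
    rw [expLoss, ← integral_integral_swap hji]
    exact integral_congr_ae (ae_of_all _ hsq)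
  have hLi : Integrable (fun p => ∫ u, residualProd h p u ∂P) (ν.prod ν) := hji.integral_prod_right
  have hS : ∑ i, (f (z i).1 - (z i).2) ^ 2 = ∫ p, ∑ i, residualProd h p (z i) ∂(ν.prod ν) := by
    rw [integral_finsetSum _ fun i _ => hz i]
    exact Finset.sum_congr rfl fun i _ => hsq (z i)
  rw [hL, hS, ← integral_const_mul, ← integral_sub (hLi.const_mul _)
    (integrable_finsetSum _ fun i _ => hz i)]
  have hbd := fun p => abs_residualProd_deviation_le h_mem P p z
  exact abs_integral_le_of_abs_le (ν.prod ν) fun p => le_ciSup (bddAbove_range_abs hbd) p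

/-! ### Learning by approximate empirical risk minimization -/

open Filter Topology in
/-- Over a countable index set, distribution function classes of families of finite fat-shattering
dimension are agnostic PAC learnable by empirical risk minimization. -/
theorem agnosticPACLearnable_distributionClass {X Y : Type*} [Nonempty Y]
    [Countable Y] (h : Y → X → ℝ) (h_mem : ∀ y x, h y x ∈ Set.Icc (0 : ℝ) 1)
    (hfat : FiniteFatShattering (Set.range h)) : AgnosticPACLearnable (distributionClass h) := by
  classical
  intro δ ε hδ hε
  -- With `ρ = 2 * θ` and `τ = 4 * θ` the deviation bound per sample is `8 * θ` plus a tail below `8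
  -- * θ`, in all `δ * ε / 4`; Markov at level `ε / 4` then gives failure probability `δ`.
  set θ := δ * ε / 64 with hθ
  have hθ0 : 0 < θ := by positivity
  obtain ⟨C, hC, hcov⟩ := exists_cover h h_mem hfat hθ0
  have hlim : Tendsto (fun n : ℕ => 4 * (((C (n + n)) ^ 2 : ℕ) : ℝ) *
      Real.exp (-(n * (4 * θ) ^ 2 / 8))) atTop (𝓝 0) := by
    have h1 := (hC (θ ^ 2 / 2) (by positivity)).comp
      (tendsto_id.atTop_add_atTop (tendsto_id (α := ℕ) (x := atTop)))
    have h2 := (h1.pow 2).const_mul 4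
    rw [zero_pow two_ne_zero, mul_zero] at h2
    refine h2.congr fun n => ?_
    simp only [Function.comp, id]
    rw [mul_pow, ← Real.exp_nat_mul]
    push_cast
    rw [← mul_assoc]
    congr 2
    ring
  obtain ⟨n₀, hn₀⟩ := eventually_atTop.1
    ((hlim.eventually_lt_const (show 0 < 8 * θ by positivity)).and (eventually_ge_atTop 1))
  obtain ⟨y₀⟩ := ‹Nonempty Y›
  have : Nonempty (distributionClass h) := ⟨⟨h y₀, mem_distributionClass h y₀⟩⟩
  -- The empirical infimum need not be attained. The slack `ε / 4` is on the sum, and `1 ≤ n` makes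
  -- it at most `n * (ε / 4)`.
  have hERM : ∀ (n : ℕ) (z : Fin n → X × Set.Icc (0 : ℝ) 1), ∃ f : distributionClass h,
      ∀ g : distributionClass h, ∑ i, ((f : X → ℝ) (z i).1 - (z i).2) ^ 2 ≤
        ∑ i, ((g : X → ℝ) (z i).1 - (z i).2) ^ 2 + ε / 4 := by
    intro n z
    let E : distributionClass h → ℝ := fun f => ∑ i, ((f : X → ℝ) (z i).1 - (z i).2) ^ 2
    have hE : BddBelow (Set.range E) :=
      ⟨0, by rintro _ ⟨f, rfl⟩; exact Finset.sum_nonneg fun i _ => sq_nonneg _⟩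
    obtain ⟨f, hf⟩ := exists_lt_of_ciInf_lt (show ⨅ f, E f < (⨅ f, E f) + ε / 4 by linarith)
    exact ⟨f, fun g => hf.le.trans (by linarith [ciInf_le hE g])⟩
  choose A hA using hERM
  refine ⟨A, n₀, fun n hn mX hmeas P hP => ?_⟩
  obtain ⟨hn1, hn2⟩ := hn₀ n hn
  have hn' : (1 : ℝ) ≤ n := by exact_mod_cast hn2
  have hm : ∀ y, Measurable (h y) := fun y => hmeas _ (mem_distributionClass h y)
  have hφm := measurable_residualProd hm
  have hb := abs_residualProd_le h_mem
  set κ := Measure.pi fun _ : Fin n => P with hR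
  let M : (Fin n → X × Set.Icc (0 : ℝ) 1) → ℝ := fun z =>
    ⨆ p, |n * ∫ u, residualProd h p u ∂P - ∑ i, residualProd h p (z i)|
  have hM0 : ∀ z, 0 ≤ M z := fun z => Real.iSup_nonneg fun p => abs_nonneg _
  have hMm : Measurable M := Measurable.iSup fun p => by
    have : Measurable fun z : Fin n → X × Set.Icc (0 : ℝ) 1 =>
        n * ∫ u, residualProd h p u ∂P - ∑ i, residualProd h p (z i) :=
      measurable_const.sub
        (Finset.measurable_sum _ fun i _ => (hφm p).comp (measurable_pi_apply i))
    exact this.abs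
  have hMb : ∀ z, M z ≤ 2 * n := fun z => ciSup_le fun p => abs_residualProd_deviation_le h_mem P p z
  have hMi : Integrable M κ :=
    Integrable.of_mem_Icc 0 (2 * n) hMm.aemeasurable (ae_of_all _ fun z => ⟨hM0 z, hMb z⟩)
  have hEM : ∫ z, M z ∂κ ≤ n * (δ * ε / 4) := by
    refine (integral_iSup_abs_deviation_le P (residualProd h) hφm hb n (C (n + n) ^ 2)
      (ρ := 2 * θ) (τ := 4 * θ) (by positivity) fun w => ?_).trans ?_
    · obtain ⟨Q, hQ, hQy⟩ := hcov (Fin n ⊕ Fin n) fun i => (w i).1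
      rw [Fintype.card_sum, Fintype.card_fin] at hQ
      refine ⟨Q ×ˢ Q, ?_, fun p => ?_⟩
      · rw [Finset.card_product, ← sq]
        exact Nat.pow_le_pow_left hQ 2
      · obtain ⟨q, hq, hqp⟩ := hQy p.1
        obtain ⟨q', hq', hqp'⟩ := hQy p.2
        refine ⟨(q, q'), Finset.mem_product.2 ⟨hq, hq'⟩, fun i => ?_⟩
        have h1 : residualProd h p (w i) - residualProd h (q, q') (w i) =
            (h p.1 (w i).1 - h q (w i).1) * (h p.2 (w i).1 - (w i).2) +
              (h q (w i).1 - (w i).2) * (h p.2 (w i).1 - h q' (w i).1) := by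
          simp only [residualProd]; ring
        rw [h1]
        refine (abs_add_le _ _).trans ?_
        rw [abs_mul, abs_mul]
        have h2 := mul_le_mul (hqp i) (abs_residual_le h_mem p.2 (w i)) (abs_nonneg _) hθ0.le
        have h3 := mul_le_mul (abs_residual_le h_mem q (w i)) (hqp' i) (abs_nonneg _) zero_le_one
        linarith
    · refine mul_le_mul_of_nonneg_left ?_ (Nat.cast_nonneg _)
      have : δ * ε / 4 = 16 * θ := by rw [hθ]; ring
      linarith
  have hMarkov := mul_meas_ge_le_integral_of_nonneg (ae_of_all _ hM0) hMi (n * (ε / 4))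
  have hreal : κ.real {z | n * (ε / 4) ≤ M z} ≤ δ := by
    have h1 := hMarkov.trans hEM
    have h2 : n * (δ * ε / 4) = n * (ε / 4) * δ := by ring
    rw [h2] at h1
    exact le_of_mul_le_mul_left h1 (by positivity)
  refine (measure_mono fun z hz => ?_).trans
    ((ENNReal.le_ofReal_iff_toReal_le (measure_ne_top κ {z | n * (ε / 4) ≤ M z}) hδ.le).2 hreal)
  by_contra hc
  simp only [Set.mem_ofPred_eq, not_le] at hc hz
  refine absurd hz (not_lt.2 ?_)
  have hdev : ∀ f : distributionClass h,
      |n * expLoss P f - ∑ i, ((f : X → ℝ) (z i).1 - (z i).2) ^ 2| ≤ n * (ε / 4) := fun f =>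
    (abs_expLoss_sub_sum_le h_mem hm P f.2 n z).trans hc.le
  rw [← sub_le_iff_le_add]
  refine le_ciInf fun g => ?_
  have h1 := (abs_le.1 (hdev (A n z))).2
  have h2 := (abs_le.1 (hdev g)).1
  have h3 := hA n z g
  have h4 : n * (expLoss P (A n z) - ε) ≤ n * expLoss P g := by nlinarith
  exact le_of_mul_le_mul_left h4 (by linarith)

/-! ### Learnability forces finite dimension -/

/-- The weight of `(i, t)` when `i` is uniform on `Fin d` and the label `t` has mean `p i`. -/
noncomputable def bernoulliWeight {d : ℕ} (p : Fin d → ℝ) (j : Fin d × Bool) : ℝ :=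
  (if j.2 then p j.1 else 1 - p j.1) / d

/-- The law of `(i, t)` for a uniform `i : Fin d` and a Bernoulli label `t` of mean `p i`. -/
noncomputable def bernoulliMeasure {d : ℕ} (p : Fin d → ℝ) : Measure (Fin d × Bool) :=
  ∑ j, ENNReal.ofReal (bernoulliWeight p j) • Measure.dirac j

/-- The labelled point coded by `(i, t)`. -/
def labelledPoint {X : Type*} {d : ℕ} (x : Fin d → X) (j : Fin d × Bool) :
    X × Set.Icc (0 : ℝ) 1 :=
  (x j.1, if j.2 then 1 else 0)

section

variable {d : ℕ} {p : Fin d → ℝ}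

lemma bernoulliWeight_nonneg (hp : ∀ i, p i ∈ Set.Icc (0 : ℝ) 1) (j : Fin d × Bool) :
    0 ≤ bernoulliWeight p j := by
  have := hp j.1
  unfold bernoulliWeight
  split_ifs
  · exact div_nonneg this.1 (Nat.cast_nonneg _)
  · exact div_nonneg (by linarith [this.2]) (Nat.cast_nonneg _)

lemma bernoulliWeight_le (hp : ∀ i, p i ∈ Set.Icc (0 : ℝ) 1) (j : Fin d × Bool) :
    bernoulliWeight p j ≤ 1 / d := by
  have := hp j.1
  unfold bernoulliWeight
  split_ifs
  · exact div_le_div_of_nonneg_right this.2 (Nat.cast_nonneg _)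
  · exact div_le_div_of_nonneg_right (by linarith [this.1]) (Nat.cast_nonneg _)

lemma sum_bernoulliWeight_mul (p : Fin d → ℝ) (F : Fin d × Bool → ℝ) :
    ∑ j, bernoulliWeight p j * F j =
      (∑ i, (p i * F (i, true) + (1 - p i) * F (i, false))) / d := by
  rw [Fintype.sum_prod_type, Finset.sum_div]
  refine Finset.sum_congr rfl fun i _ => ?_
  simp only [Fintype.sum_bool, bernoulliWeight, if_true, Bool.false_eq_true, if_false]
  ring

lemma isProbabilityMeasure_bernoulliMeasure (hd : 0 < d) (hp : ∀ i, p i ∈ Set.Icc (0 : ℝ) 1) :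
    IsProbabilityMeasure (bernoulliMeasure p) := by
  refine ⟨?_⟩
  have h := sum_bernoulliWeight_mul p fun _ => 1
  have hd' : (d : ℝ) ≠ 0 := by positivity
  simp only [mul_one, add_sub_cancel, Finset.sum_const, Finset.card_univ, Fintype.card_fin,
    nsmul_eq_mul, div_self hd'] at h
  simp only [bernoulliMeasure, Measure.coe_finsetSum, Finset.sum_apply, Measure.smul_apply,
    measure_univ, smul_eq_mul, mul_one]
  rw [← ENNReal.ofReal_sum_of_nonneg fun j _ => bernoulliWeight_nonneg hp j, h,
    ENNReal.ofReal_one]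

lemma bernoulliMeasure_singleton_le (hp : ∀ i, p i ∈ Set.Icc (0 : ℝ) 1) (j : Fin d × Bool) :
    bernoulliMeasure p {j} ≤ ENNReal.ofReal (1 / d) := by
  have : bernoulliMeasure p {j} = ENNReal.ofReal (bernoulliWeight p j) := by
    simp only [bernoulliMeasure, Measure.coe_finsetSum, Finset.sum_apply, Measure.smul_apply,
      smul_eq_mul]
    rw [Finset.sum_eq_single j]
    · simp
    · intro k _ hk
      simp [hk]
    · simp
  rw [this]
  exact ENNReal.ofReal_le_ofReal (bernoulliWeight_le hp j)

lemma integral_bernoulliMeasure (hp : ∀ i, p i ∈ Set.Icc (0 : ℝ) 1) (F : Fin d × Bool → ℝ) :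
    ∫ j, F j ∂(bernoulliMeasure p) = ∑ j, bernoulliWeight p j * F j := by
  rw [bernoulliMeasure, integral_finsetSum_measure fun j _ =>
    (integrable_dirac (by simp)).smul_measure ENNReal.ofReal_ne_top]
  refine Finset.sum_congr rfl fun j _ => ?_
  rw [integral_smul_measure, integral_dirac, ENNReal.toReal_ofReal (bernoulliWeight_nonneg hp j),
    smul_eq_mul]

/-- Bias–variance decomposition: the label noise does not depend on `g`, so excess loss over a
function with values `p i` is the mean squared distance to it. -/
lemma expLoss_map_bernoulliMeasure {X : Type*} [MeasurableSpace X] (x : Fin d → X)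
    (hp : ∀ i, p i ∈ Set.Icc (0 : ℝ) 1) {g : X → ℝ} (hg : Measurable g) :
    expLoss ((bernoulliMeasure p).map (labelledPoint x)) g =
      (∑ i, ((g (x i) - p i) ^ 2 + p i * (1 - p i))) / d := by
  have hm : Measurable fun z : X × Set.Icc (0 : ℝ) 1 => (g z.1 - z.2) ^ 2 :=
    ((hg.comp measurable_fst).sub (measurable_subtype_coe.comp measurable_snd)).pow_const 2
  rw [expLoss, integral_map (Measurable.of_discrete).aemeasurable hm.aestronglyMeasurable,
    integral_bernoulliMeasure hp, sum_bernoulliWeight_mul]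
  congr 1
  refine Finset.sum_congr rfl fun i _ => ?_
  simp only [labelledPoint, if_true, Bool.false_eq_true, if_false, Set.Icc.coe_one,
    Set.Icc.coe_zero]
  ring

/-- Each atom has mass at most `1 / d` whatever `p` is, so probabilities are bounded by counting,
uniformly over the laws. -/
lemma pi_bernoulliMeasure_le (hd : 0 < d) (hp : ∀ i, p i ∈ Set.Icc (0 : ℝ) 1) {n : ℕ}
    (G : Finset (Fin n → Fin d × Bool)) :
    Measure.pi (fun _ : Fin n => bernoulliMeasure p) G ≤ ENNReal.ofReal (G.card / d ^ n) := by
  have := isProbabilityMeasure_bernoulliMeasure hd hp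
  rw [← sum_measure_singleton]
  have h1 : ∀ u ∈ G, Measure.pi (fun _ : Fin n => bernoulliMeasure p) {u} ≤
      ENNReal.ofReal (1 / d) ^ n := by
    intro u _
    rw [Measure.pi_singleton]
    refine (Finset.prod_le_prod' fun i _ => bernoulliMeasure_singleton_le hp (u i)).trans_eq ?_
    simp
  refine (Finset.sum_le_card_nsmul _ _ _ h1).trans_eq ?_
  rw [nsmul_eq_mul, ← ENNReal.ofReal_pow (by positivity), ← ENNReal.ofReal_natCast,
    ← ENNReal.ofReal_mul (by positivity)]
  congr 1
  rw [one_div, inv_pow, div_eq_mul_inv]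

end

/-- Hypotheses that are nearly optimal for the Bernoulli labels of `f b` determine most of `b`. -/
lemma card_near_optimal_le {X : Type*} {d : ℕ} (hd : 0 < d) (x : Fin d → X) (s : Fin d → ℝ)
    {γ : ℝ} (hγ : 0 < γ) (f : (Fin d → Bool) → X → ℝ)
    (hf : ∀ b i, (b i = true → s i + γ ≤ f b (x i)) ∧ (b i = false → f b (x i) ≤ s i - γ))
    (g : X → ℝ) (S : Finset (Fin d → Bool))
    (hS : ∀ b ∈ S, (∑ i, (g (x i) - f b (x i)) ^ 2) ≤ d * (γ ^ 2 / 4)) :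
    (S.card : ℝ) ≤ 2 ^ d * Real.exp (-(1 / 8 * d)) := by
  classical
  -- The sign pattern decoded from `g`. A wrongly decoded coordinate costs at least `γ ^ 2` in
  -- squared distance, so near-optimality forces correlation at least `d / 2` with `b`.
  let a : Fin d → ℝ := fun i => if s i ≤ g (x i) then 1 else -1
  have h := card_sgn_sum_ge_le a one_pos (show (0 : ℝ) ≤ 1 / 2 by norm_num) (fun i => by
    simp only [a]; split_ifs <;> simp) S fun b hb => ?_
  · rw [Fintype.card_fin] at h
    refine h.trans_eq ?_
    congr 2
    ring
  · rw [Fintype.card_fin]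
    have hγ2 : 0 < γ ^ 2 := by positivity
    have h1 : ∀ i, 1 - 2 / γ ^ 2 * (g (x i) - f b (x i)) ^ 2 ≤ sgn (b i) * a i := by
      intro i
      have hnn : 0 ≤ 2 / γ ^ 2 * (g (x i) - f b (x i)) ^ 2 := by positivity
      have hbig : γ ^ 2 ≤ (g (x i) - f b (x i)) ^ 2 →
          1 - 2 / γ ^ 2 * (g (x i) - f b (x i)) ^ 2 ≤ -1 := by
        intro hle
        have := mul_le_mul_of_nonneg_left hle (show 0 ≤ 2 / γ ^ 2 by positivity)
        rw [div_mul_cancel₀ _ hγ2.ne'] at this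
        linarith
      have hfb := hf b i
      cases hbi : b i
      · have h2 := hfb.2 hbi
        by_cases hs : s i ≤ g (x i)
        · simp only [a, sgn, if_pos hs, Bool.false_eq_true, if_false, mul_one]
          exact hbig (by nlinarith)
        · simp only [a, sgn, if_neg hs, Bool.false_eq_true, if_false, mul_neg, mul_one, neg_neg]
          linarith
      · have h2 := hfb.1 hbi
        by_cases hs : s i ≤ g (x i)
        · simp only [a, sgn, if_pos hs, if_true, mul_one]
          linarith
        · simp only [a, sgn, if_neg hs, if_true, one_mul]
          exact hbig (by nlinarith)
    have h2 := Finset.sum_le_sum fun i (_ : i ∈ Finset.univ) => h1 i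
    rw [Finset.sum_sub_distrib, ← Finset.mul_sum] at h2
    simp only [Finset.sum_const, Finset.card_univ, Fintype.card_fin, nsmul_eq_mul, mul_one] at h2
    have h3 := mul_le_mul_of_nonneg_left (hS b hb) (show 0 ≤ 2 / γ ^ 2 by positivity)
    have h4 : 2 / γ ^ 2 * (d * (γ ^ 2 / 4)) = d * (1 / 2) := by field_simp; norm_num
    linarith

open Filter Topology in
/-- Agnostic PAC learnable classes have finite fat-shattering dimension. -/
theorem AgnosticPACLearnable.finiteFatShattering {X : Type*} {F : Set (X → ℝ)}
    (hF01 : ∀ f ∈ F, ∀ x, f x ∈ Set.Icc (0 : ℝ) 1) (hF : AgnosticPACLearnable F) :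
    FiniteFatShattering F := by
  classical
  intro γ hγ _
  obtain ⟨A, n, hA⟩ := hF (1 / 2) (γ ^ 2 / 4) (by norm_num) (by positivity)
  have hlim : Tendsto (fun d : ℕ => (2 : ℝ) ^ n * Real.exp (-(1 / 8 * d))) atTop (𝓝 0) := by
    have h1 : Tendsto (fun d : ℕ => Real.exp (-(1 / 8 * (d : ℝ)))) atTop (𝓝 0) :=
      Real.tendsto_exp_neg_atTop_nhds_zero.comp
        (tendsto_natCast_atTop_atTop.const_mul_atTop (by norm_num))
    simpa using h1.const_mul ((2 : ℝ) ^ n)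
  obtain ⟨d, hd, hd0⟩ := ((hlim.eventually_lt_const (show (0 : ℝ) < 1 / 2 by norm_num)).and
    (eventually_gt_atTop 0)).exists
  refine fatShatteringDim_lt_top d fun x s _ hsh => ?_
  let _ : MeasurableSpace X := ⊤
  choose f hfF hf using hsh
  let p : (Fin d → Bool) → Fin d → ℝ := fun b i => f b (x i)
  have hp : ∀ b i, p b i ∈ Set.Icc (0 : ℝ) 1 := fun b i => hF01 _ (hfF b) _
  have hQ : ∀ b, IsProbabilityMeasure (bernoulliMeasure (p b)) := fun b =>
    isProbabilityMeasure_bernoulliMeasure hd0 (hp b)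
  let P : (Fin d → Bool) → Measure (X × Set.Icc (0 : ℝ) 1) := fun b =>
    (bernoulliMeasure (p b)).map (labelledPoint x)
  have hlm : Measurable (labelledPoint x) := Measurable.of_discrete
  have hP : ∀ b, IsProbabilityMeasure (P b) := fun b =>
    Measure.isProbabilityMeasure_map hlm.aemeasurable
  let g : (Fin n → Fin d × Bool) → X → ℝ := fun u => A n fun i => labelledPoint x (u i)
  let Good : (Fin d → Bool) → Finset (Fin n → Fin d × Bool) := fun b =>
    Finset.univ.filter fun u => ∑ i, (g u (x i) - f b (x i)) ^ 2 ≤ d * (γ ^ 2 / 4)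
  have hdpos : (0 : ℝ) < d := by exact_mod_cast hd0
  -- The good samples have probability at least `1 / 2`. Outer measure suffices: failures and good
  -- samples cover everything, and subadditivity applies.
  have hgood : ∀ b, (d : ℝ) ^ n / 2 ≤ (Good b).card := by
    intro b
    have h1 := hA n le_rfl (fun _ _ => measurable_from_top) (P b) (hP b)
    have h2 : Measure.pi (fun _ : Fin n => P b) = (Measure.pi fun _ : Fin n =>
        bernoulliMeasure (p b)).map fun u i => labelledPoint x (u i) := by
      rw [Measure.pi_map_pi fun _ => hlm.aemeasurable]
    rw [h2] at h1
    have h3 := (Measure.le_map_apply (Measurable.of_discrete).aemeasurable _).trans h1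
    have h4 : (Set.univ : Set (Fin n → Fin d × Bool)) ⊆
        ((fun u i => labelledPoint x (u i)) ⁻¹' {z | ¬ expLoss (P b) (A n z : X → ℝ) ≤
          bestExpLoss (P b) F + γ ^ 2 / 4}) ∪ (Good b : Set (Fin n → Fin d × Bool)) := by
      intro u _
      by_contra hu
      simp only [Set.mem_union, Set.mem_preimage, Set.mem_ofPred_eq, not_or, not_not] at hu
      refine hu.2 (Finset.mem_coe.2 (Finset.mem_filter.2 ⟨Finset.mem_univ _, ?_⟩))
      have h5 : bestExpLoss (P b) F ≤ expLoss (P b) (f b) :=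
        ciInf_le (f := fun f : F => expLoss (P b) (f : X → ℝ))
          ⟨0, by rintro _ ⟨f, rfl⟩; exact integral_nonneg fun _ => sq_nonneg _⟩ ⟨f b, hfF b⟩
      have h6 : expLoss (P b) (g u) ≤ expLoss (P b) (f b) + γ ^ 2 / 4 :=
        hu.1.trans (by linarith)
      simp only [P] at h6
      rw [expLoss_map_bernoulliMeasure x (hp b) measurable_from_top,
        expLoss_map_bernoulliMeasure x (hp b) measurable_from_top, ← sub_le_iff_le_add',
        ← sub_div, div_le_iff₀ hdpos, ← Finset.sum_sub_distrib] at h6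
      simpa [p, mul_comm] using h6
    have h5 := (measure_mono h4).trans (measure_union_le (μ := Measure.pi fun _ : Fin n =>
        bernoulliMeasure (p b)) _ _)
    rw [measure_univ] at h5
    have h6 := h5.trans (add_le_add h3 (pi_bernoulliMeasure_le hd0 (hp b) (Good b)))
    rw [← ENNReal.ofReal_add (by norm_num) (by positivity), ENNReal.one_le_ofReal] at h6
    have h7 : (1 : ℝ) / 2 ≤ (Good b).card / d ^ n := by linarith
    rw [le_div_iff₀ (by positivity)] at h7
    linarith
  -- Double counting: each of the `(2 * d) ^ n` samples is good for few `b`. As `n` was fixed before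
  -- `d`, this contradicts the lower bound `d ^ n / 2` for every `b`.
  have hcount : ∑ b, ((Good b).card : ℝ) ≤
      (2 * d : ℝ) ^ n * (2 ^ d * Real.exp (-(1 / 8 * d))) := by
    have h1 : ∑ b, (Good b).card = ∑ u, (Finset.univ.filter fun b =>
        ∑ i, (g u (x i) - f b (x i)) ^ 2 ≤ d * (γ ^ 2 / 4)).card := by
      simp only [Good, Finset.card_filter]
      exact Finset.sum_comm
    have h2 : ∀ u ∈ (Finset.univ : Finset (Fin n → Fin d × Bool)),
        ((Finset.univ.filter fun b =>
        ∑ i, (g u (x i) - f b (x i)) ^ 2 ≤ d * (γ ^ 2 / 4)).card : ℝ) ≤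
        2 ^ d * Real.exp (-(1 / 8 * d)) := fun u _ =>
      card_near_optimal_le hd0 x s hγ f hf (g u) _ fun b hb => (Finset.mem_filter.1 hb).2
    have h3 := Finset.sum_le_card_nsmul _ _ _ h2
    rw [← Nat.cast_sum, h1, Nat.cast_sum]
    refine h3.trans_eq ?_
    rw [nsmul_eq_mul, Finset.card_univ, Fintype.card_fun, Fintype.card_prod, Fintype.card_fin,
      Fintype.card_bool, Fintype.card_fin]
    push_cast
    rw [mul_comm (d : ℝ) 2]
  have hlow := Finset.card_nsmul_le_sum Finset.univ (fun b => ((Good b).card : ℝ)) _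
    fun b _ => hgood b
  rw [nsmul_eq_mul, Finset.card_univ, Fintype.card_fun, Fintype.card_bool, Fintype.card_fin] at hlow
  have h1 := hlow.trans hcount
  have h2 : (0 : ℝ) < 2 ^ d * d ^ n := by positivity
  have h3 : (2 * d : ℝ) ^ n * (2 ^ d * Real.exp (-(1 / 8 * d))) =
      2 ^ d * d ^ n * (2 ^ n * Real.exp (-(1 / 8 * d))) := by rw [mul_pow]; ring
  have h4 := mul_lt_mul_of_pos_left hd h2
  rw [h3] at h1
  push_cast at h1
  linarith

end HypothesisClass

/-! ### The theorem -/

theorem mainTheorem5 {X Y : Type*} [Nonempty X] [Nonempty Y] (h : Y → X → ℝ)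
    (h_mem : ∀ y x, h y x ∈ Set.Icc (0 : ℝ) 1)
    (hyp : HypothesisClass.AgnosticPACLearnable (Set.range h) ∨
      HypothesisClass.FiniteFatShattering (Set.range h)) :
    (HypothesisClass.FiniteFatShattering (HypothesisClass.dualDistributionClass h) ∧
      HypothesisClass.FiniteFatShattering (HypothesisClass.distributionClass h)) ∧
    (Countable X →
      HypothesisClass.AgnosticPACLearnable (HypothesisClass.dualDistributionClass h)) ∧
    (Countable Y →
      HypothesisClass.AgnosticPACLearnable (HypothesisClass.distributionClass h)) := by
  have hfat : HypothesisClass.FiniteFatShattering (Set.range h) :=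
    hyp.elim (fun hl => hl.finiteFatShattering (by rintro _ ⟨y, rfl⟩ x; exact h_mem y x)) id
  have hdual := hfat.dualFamily
  have hdual_mem : ∀ x y, HypothesisClass.dualFamily h x y ∈ Set.Icc (0 : ℝ) 1 :=
    fun x y => h_mem y x
  exact ⟨⟨hdual.distributionClass _ hdual_mem, hfat.distributionClass _ h_mem⟩,
    fun _ => HypothesisClass.agnosticPACLearnable_distributionClass _ hdual_mem hdual,
    fun _ => HypothesisClass.agnosticPACLearnable_distributionClass _ h_mem hfat⟩
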